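/- Setting. Let $G$ be a countable group with a normal subgroup $G'$ of finite index and an isomorphism $\mathbb Z^r\cong G'$, $r\ge 1$ (used to regard subsets of $\mathbb Z^r$ as subsets of $G$), and let $R\ni 1_G$ be a set of representatives of $G/G'$. For $i\ge 1$ let $$\Gamma_i=\prod_{j=1}^r p^i_j\mathbb Z\le G',\qquad D_i=\{x\in\mathbb Z^r:-q^i_{1,j}\le x_j<q^i_{2,j},\ 1\le j\le r\},$$ where the positive integers $p^i_j,q^i_{1,j},q^i_{2,j}$ satisfy, for all $i\ge1$ and $1\le j\le r$: $p^i_j<p^{i+1}_j$, $p^i_j\mid p^{i+1}_j$, $p^i_j>2i+1$, $q^i_{1,j},q^i_{2,j}>i$, $q^i_{1,j}+q^i_{2,j}=p^i_j$, $$D_{i+1}=\bigcup_{\gamma\in D_{i+1}\cap\Gamma_i}(\gamma+D_i),\qquad [\Gamma_i:\Gamma_{i+1}]>\frac1{1-1/2^{(1/2)^{i+1}}}.$$ The array. Let $m\ge1$, let $\beta\notin\{1,\dots,m\}$, $\Sigma=\{1,\dots,m,\beta\}$, and let $\alpha_i\in\{1,\dots,m\}$, $\alpha_i\equiv i\pmod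 m$. Put $J(0)=\{1_G\}$ and $J(n)=D_n\setminus\bigcup_{i=0}^{n-1}\Gamma_{i+1}J(i)$ for $n\ge1$. Define $\eta\in\Sigma^G$ by $\eta=\alpha_1$ on $\Gamma_1$, $\eta=\beta$ on $\Gamma_1(R\setminus\{1_G\})$, and $\eta=\alpha_{n+1}$ on $\Gamma_{n+1}J(n)R$ for $n\ge1$. Let $\sigma^gx(h)=x(g^{-1}h)$ be the shift action of $G$ on $\Sigma^G$ and $X=\overline{O_\sigma(\eta)}$ the orbit closure of $\eta$ (product topology). An invariant measure is a Borel probability measure $\mu$ on $X$ with $\mu(\sigma^gA)=\mu(A)$ for all $g\in G$ and all Borel $A$; it is ergodic if $\mu(A)\in\{0,1\}$ for every Borel $A$ with $\sigma^gA=A$ for all $g$. Let $[a]=\{x:x(1_G)=a\}$. For $n\ge1$ let $\eta_n\in\Sigma^G$ be given by $\eta_n(\gamma u)=\eta(u)$ for $\gamma\in\Gamma_n$, $u\in D_nR$, and let $$\mu_n=\frac1{|D_nR|}\sum_{u\in D_nR}\delta_{\sigma^{u^{-1}}\eta_n}.$$ Let $\mathrm{Per}(\eta,\Gamma_n,a)=\{g\in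 G:\eta(\gamma^{-1}g)=a\text{ for all }\gamma\in\Gamma_n\}$ and $\mathrm{Per}(\eta,\Gamma_n)=\bigcup_{a\in\Sigma}\mathrm{Per}(\eta,\Gamma_n,a)$. Claim. The limits $$t_a=\lim_{n\to\infty}\frac{|D_nR\cap\mathrm{Per}(\eta,\Gamma_n,a)|}{|D_nR|}\ (a\in\Sigma),\qquad d=\lim_{n\to\infty}\frac{|D_nR\cap\mathrm{Per}(\eta,\Gamma_n)|}{|D_nR|}$$ exist, and with $\vec t_i=(t_1,\dots,t_{i-1},1-d+t_i,t_{i+1},\dots,t_m,t_\beta)\in\mathbb R^{m+1}$ for $1\le i\le m$ the following holds. 1. The system $(X,\sigma,G)$ has exactly $m$ ergodic measures $\nu_1,\dots,\nu_m$ (pairwise distinct), and for each $i$ the periodic measures $\mu_{i+sm-1}$ converge weakly to $\nu_i$ as $s\to\infty$ (as measures on $\Sigma^G$). 2. The vectors $\vec t_1,\dots,\vec t_m$ are linearly independent, so that their convex hull $\triangle$ is an $(m-1)$-simplex; the map $\mu\mapsto(\mu([1]),\dots,\mu([m]),\mu([\beta]))$ is an affine bijection from the convex set of invariant measures of $(X,\sigma,G)$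 onto $\triangle$, and it sends $\nu_i$ to $\vec t_i$ for $1\le i\le m$. -/

import Mathlib

open Filter Topology MeasureTheory Set
open scoped Pointwise

noncomputable section

namespace VirtToeplitz

/-! ### Dynamics: invariant and ergodic measures of a family of maps `φ g`, `g : G` -/

/-- Invariant measures: probability measures `μ` with `μ (φ^g A) = μ A` for every `g` and every
measurable `A`. -/
def IsInvariantMeasure {G X : Type*} [MeasurableSpace X] (φ : G → X → X) (μ : Measure X) : Prop :=
  IsProbabilityMeasure μ ∧ ∀ (g : G) (A : Set X), MeasurableSet A → μ (φ g '' A) = μ A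

/-- Ergodic measures: invariant measures giving measure `0` or `1` to every measurable set `A` with
`φ^g A = A` for all `g`. -/
def IsErgodicMeasure {G X : Type*} [MeasurableSpace X] (φ : G → X → X) (μ : Measure X) : Prop :=
  IsInvariantMeasure φ μ ∧
    ∀ A : Set X, MeasurableSet A → (∀ g, φ g '' A = A) → μ A = 0 ∨ μ A = 1

section Shift

variable {G A : Type*} [Group G]

/-- The left shift `σ^g x (h) = x (g⁻¹ h)` on `A^G`. -/
def shift (g : G) (x : G → A) : G → A := fun h => x (g⁻¹ * h)

/-- The closure of the shift orbit of `x`, for the product topology on `A^G`. -/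
def orbitClosure [TopologicalSpace A] (x : G → A) : Set (G → A) :=
  closure (range fun g : G => shift g x)

theorem shift_mem_orbitClosure [TopologicalSpace A] {x y : G → A} (g : G)
    (hy : y ∈ orbitClosure x) : shift g y ∈ orbitClosure x := by
  have hc : Continuous (shift g : (G → A) → (G → A)) :=
    continuous_pi fun h => continuous_apply (g⁻¹ * h)
  refine map_mem_closure hc hy ?_
  rintro _ ⟨k, rfl⟩
  refine ⟨g * k, ?_⟩
  funext h
  simp [shift, mul_assoc]

/-- The shift action on the subshift `orbitClosure x`. -/
def subshiftAction [TopologicalSpace A] (x : G → A) (g : G) (y : orbitClosure x) :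
    orbitClosure x :=
  ⟨shift g y.1, shift_mem_orbitClosure g y.2⟩

/-- `Per(x, Γ, a)`: the positions `g` with `x (γ⁻¹ g) = a` for all `γ ∈ Γ`. -/
def Per (x : G → A) (Γ : Subgroup G) (a : A) : Set G := {g | ∀ γ ∈ Γ, x (γ⁻¹ * g) = a}

/-- `Per(x, Γ)`: the union of the sets `Per(x, Γ, a)`. -/
def PerAll (x : G → A) (Γ : Subgroup G) : Set G := ⋃ a, Per x Γ a

end Shift

/-! ### Lattices and boxes in `ℤ^r`, transported to `G` through `e : ℤ^r ≃ G'` -/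

section Lattice

variable {G : Type*} [Group G] {G' : Subgroup G} {r : ℕ}

/-- The lattice `⟨p_j e_j : j⟩ = ∏_j p_j ℤ` of `ℤ^r`. -/
def lattice (p : Fin r → ℕ) : AddSubgroup (Fin r → ℤ) :=
  AddSubgroup.pi univ fun j => AddSubgroup.zmultiples (p j : ℤ)

/-- The box `{x : -q₁_j ≤ x_j < q₂_j for all j}` of `ℤ^r`. -/
def box (q₁ q₂ : Fin r → ℕ) : Finset (Fin r → ℤ) :=
  Fintype.piFinset fun j => Finset.Ico (-(q₁ j : ℤ)) (q₂ j : ℤ)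

/-- The lattice `lattice p`, as a subgroup of `G` contained in `G' ≅ ℤ^r`. -/
def latticeIn (e : Multiplicative (Fin r → ℤ) ≃* G') (p : Fin r → ℕ) : Subgroup G :=
  (AddSubgroup.toSubgroup (lattice p)).map (G'.subtype.comp e.toMonoidHom)

open Classical in
/-- The box `box q₁ q₂`, as a finite subset of `G` contained in `G' ≅ ℤ^r`. -/
def boxIn (e : Multiplicative (Fin r → ℤ) ≃* G') (q₁ q₂ : Fin r → ℕ) : Finset G :=
  (box q₁ q₂).image fun v => ((e (Multiplicative.ofAdd v) : G') : G)

end Lattice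

/-! ### The array `η`

The alphabet `{1, …, m, β}` is `Fin (m + 1)`: the symbol `i + 1` is `Fin.castSucc i` for
`i : Fin m`, and `β` is `Fin.last m`.  The sequences `Γ` and `D` matter for indices `≥ 1` only. -/

section Array

variable {G : Type*} [Group G] (Γ : ℕ → Subgroup G) (D : ℕ → Finset G) (R : Finset G)

/-- `J(0) = {1}` and `J(n) = D_n \ ⋃_{0 ≤ i < n} Γ_{i+1} J(i)` for `n ≥ 1`. -/
def J : ℕ → Set G
  | 0 => {1}
  | n + 1 => (D (n + 1) : Set G) \ ⋃ i : Fin (n + 1), (Γ (i.1 + 1) : Set G) * J i.1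

/-- The set `Γ_{n+1} J(n) R` treated at step `n + 1`. -/
def stepSet (n : ℕ) : Set G := (Γ (n + 1) : Set G) * J Γ D n * (R : Set G)

open Classical in
/-- The finite set `D_n R`. -/
def DR (n : ℕ) : Finset G := D n * R

variable (m : ℕ) [NeZero m]

/-- `alphaSucc m n` is `α_{n+1}`, the symbol of `{1, …, m}` congruent to `n + 1` modulo `m`. -/
def alphaSucc (n : ℕ) : Fin (m + 1) := (Fin.ofNat m n).castSucc

open Classical in
/-- The array `η`: it is `β` on `Γ_1 (R \ {1})`, `α_1` on the rest `Γ_1` of `Γ_1 J(0) R`, and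
`α_{n+1}` on `Γ_{n+1} J(n) R` for `n ≥ 1`.  (These sets are disjoint and cover the group; the last
branch is never reached.) -/
def eta (g : G) : Fin (m + 1) :=
  if g ∈ (Γ 1 : Set G) * ((R : Set G) \ {1}) then Fin.last m
  else if h : ∃ n, g ∈ stepSet Γ D R n then alphaSucc m (Nat.find h)
  else Fin.last m

open Classical in
/-- The periodic array `η_n`, with `η_n (γ u) = η (u)` for `γ ∈ Γ_n` and `u ∈ D_n R`.
(For `n ≥ 1` every `g` is `γ u` for exactly one such pair.) -/
def etaPeriodic (n : ℕ) (g : G) : Fin (m + 1) :=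
  if h : ∃ u ∈ DR D R n, g * u⁻¹ ∈ Γ n then eta Γ D R m h.choose else Fin.last m

/-- The periodic measure `μ_n = |D_n R|⁻¹ ∑_{u ∈ D_n R} δ_{σ^{u⁻¹} η_n}` on the full shift.
The product σ-algebra is the Borel one, `G` being countable. -/
def periodicMeasure (n : ℕ) : Measure (G → Fin (m + 1)) :=
  ((DR D R n).card : ENNReal)⁻¹ •
    ∑ u ∈ DR D R n, Measure.dirac (shift u⁻¹ (etaPeriodic Γ D R m n))

/-- `|D_n R ∩ S| / |D_n R|`. -/
def density (n : ℕ) (S : Set G) : ℝ :=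
  (((DR D R n : Set G) ∩ S).ncard : ℝ) / ((DR D R n).card : ℝ)

/-- The Toeplitz subshift: the orbit closure of `η`. -/
abbrev ToeplitzSubshift : Type _ := orbitClosure (eta Γ D R m)

/-- The map `p(μ) = (μ([1]), …, μ([m]), μ([β]))`, where `[a]` is the set of `x` with `x(1) = a`. -/
def symbolVector (μ : Measure (ToeplitzSubshift Γ D R m)) : Fin (m + 1) → ℝ :=
  fun a => μ.real {x | x.1 1 = a}

end Array

/-- The vector `(t_1, …, t_{i-1}, 1 - d + t_i, t_{i+1}, …, t_m, t_β)`. -/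
def vertex {m : ℕ} (t : Fin (m + 1) → ℝ) (d : ℝ) (i : Fin m) : Fin (m + 1) → ℝ :=
  fun a => if a = i.castSucc then 1 - d + t a else t a

end VirtToeplitz

end

open VirtToeplitz

/-! Give each `v` in `ℤ^r` a level: the first `n` with `v ∈ B n + Λ (n+1)`, where the tower is
completed by the trivial box `{0}` at index `0`. The step `Γ_{n+1} J(n) R` fills exactly the points
of `G` whose `ℤ^r`-coordinate has level `n`, so `η` is a function of the level and the coset
representative. Levels below `n` are `Λ n`-periodic. All points of level at least `n` in one
translate `γ + B n` have the same level (`level_add_congr`), since larger boxes are unions of whole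
translates of `B n`. Hence for `n ≥ 1` each translate of `D_n R` by `Γ_n` carries one of only `m`
blocks: a fixed periodic part, with one symbol of `{1, …, m}` in every gap. The gap proportion is a
product of factors `1 - |B i| / |B (i+1)|`, and the growth condition on the indices keeps its limit
positive.

Every point of the orbit closure is cut into such blocks after a shift from a finite set. Averaging
over these alignments and using invariance (`integral_alignedAvg_avg`) shows that `∫ f dμ` is, up to
a Følner boundary error, a convex combination with weights `c a` of averages of `f` along the `m`
blocks. For indicators of symbols there is no error: `μ([a])` equals the periodic frequency of `a`
plus `c a` times the gap proportion. As the gap proportion is nonzero, the symbol vector determines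
the weights, and so determines `μ` (`eq_of_symbols_eq`). In the limit, symbol vectors lie in the
convex hull of the `m` vectors `extremeVec a`, which are linearly independent because the limit gap
is positive.

Conversely, a limit of empirical measures along blocks of type `a` is invariant with vector
`extremeVec a`. The invariant measures are therefore a simplex with these `m` measures as vertices.
Vertices are ergodic, since conditioning on an invariant set would split them. An ergodic measure
dominates some vertex in its decomposition, hence equals it. Finally `η_n` carries the block with
gap symbol `α_{n+1}`, so along a residue class of `n` modulo `m` the measures `μ_n` converge to a
single vertex. -/

namespace VirtToeplitz

/-! ### Box towers: levels, tilings and the proportion of gaps. -/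

/-- A decreasing sequence of subgroups `Λ n` of an abelian group, with finite fundamental domains
`B n` that are nested (each is a union of translates of the previous one), exhaust the group,
form a Følner sequence and grow fast enough. -/
structure BoxTower (V : Type*) [AddCommGroup V] where
  Λ : ℕ → AddSubgroup V
  B : ℕ → Finset V
  anti : ∀ n, Λ (n + 1) ≤ Λ n
  zero_mem : ∀ n, (0 : V) ∈ B n
  exists_rep : ∀ n v, ∃ d ∈ B n, v - d ∈ Λ n
  unique : ∀ n, ∀ d ∈ B n, ∀ d' ∈ B n, d - d' ∈ Λ n → d = d'
  tile : ∀ n, ∀ γ ∈ Λ n, ∀ d ∈ B n, γ + d ∈ B (n + 1) ↔ γ ∈ B (n + 1)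
  exhaust : ∀ v, ∃ n, v ∈ B n
  folner : ∀ w, Tendsto (fun n => (({d ∈ (B n : Set V) | d + w ∉ B n}).ncard : ℝ) / (B n).card)
    atTop (𝓝 0)
  prod_bound : ∃ c : ℝ, 0 < c ∧
    ∀ n, c ≤ ∏ i ∈ Finset.range n, (1 - ((B i).card : ℝ) / (B (i + 1)).card)

namespace BoxTower

variable {V : Type*} [AddCommGroup V] (T : BoxTower V)

theorem antitone : Antitone T.Λ := antitone_nat_of_succ_le T.anti

/-- Induction on `N`: with `d₁` the representative of `γ` in `B N`, the induction hypothesis puts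
`d₁ + d` in `B N` too, so both sides reduce to `γ - d₁ ∈ B (N + 1)`. -/
theorem tile_le {n N : ℕ} (h : n ≤ N) {γ d : V} (hγ : γ ∈ T.Λ n) (hd : d ∈ T.B n) :
    γ + d ∈ T.B N ↔ γ ∈ T.B N := by
  induction N, h using Nat.le_induction generalizing γ d with
  | base =>
    constructor
    · intro h
      have := T.unique n _ h d hd (by simpa using hγ)
      have h0 : γ = 0 := by simpa using this
      rw [h0]; exact T.zero_mem n
    · intro h
      have := T.unique n _ h 0 (T.zero_mem n) (by simpa using hγ)
      simpa [this] using hd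
  | succ N hN ih =>
    obtain ⟨d₁, hd₁, h₁⟩ := T.exists_rep N γ
    have hd₁' : d₁ ∈ T.Λ n := by
      have := sub_mem hγ (T.antitone hN h₁)
      simpa using this
    have h2 : d₁ + d ∈ T.B N := (ih hd₁' hd).2 hd₁
    have e1 : γ + d = (γ - d₁) + (d₁ + d) := by abel
    have e2 : γ = (γ - d₁) + d₁ := by abel
    rw [e1, T.tile N _ h₁ _ h2]
    conv_rhs => rw [e2]
    rw [T.tile N _ h₁ _ hd₁]

/-- The `Λ (n + 1)`-periodic set generated by the box `B n`. -/
def E (n : ℕ) : Set V := {v | ∃ d ∈ T.B n, v - d ∈ T.Λ (n + 1)}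

theorem exists_mem_E (v : V) : ∃ n, v ∈ T.E n := by
  obtain ⟨n, hn⟩ := T.exhaust v
  exact ⟨n, v, hn, by simp⟩

open Classical in
/-- The first `n` for which `v` belongs to `E n`. -/
noncomputable def level (v : V) : ℕ := Nat.find (T.exists_mem_E v)

theorem mem_E_level (v : V) : v ∈ T.E (T.level v) := by
  classical exact Nat.find_spec (T.exists_mem_E v)

theorem level_le_iff {v : V} {n : ℕ} : T.level v ≤ n ↔ ∃ k ≤ n, v ∈ T.E k := by
  classical exact Nat.find_le_iff _ _

theorem le_level_iff {v : V} {n : ℕ} : n ≤ T.level v ↔ ∀ k < n, v ∉ T.E k := by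
  classical exact Nat.le_find_iff _ _

theorem level_eq_of_iff {v w : V} (h : ∀ n, v ∈ T.E n ↔ w ∈ T.E n) : T.level v = T.level w := by
  apply le_antisymm
  · exact T.level_le_iff.2 ⟨_, le_rfl, (h _).2 (T.mem_E_level w)⟩
  · exact T.level_le_iff.2 ⟨_, le_rfl, (h _).1 (T.mem_E_level v)⟩

theorem level_le {v : V} {n : ℕ} (h : v ∈ T.B n) : T.level v ≤ n :=
  T.level_le_iff.2 ⟨n, le_rfl, v, h, by simp⟩

theorem add_mem_E_iff {n : ℕ} {γ : V} (hγ : γ ∈ T.Λ (n + 1)) (v : V) :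
    γ + v ∈ T.E n ↔ v ∈ T.E n := by
  constructor
  · rintro ⟨d, hd, h⟩
    refine ⟨d, hd, ?_⟩
    have := sub_mem h hγ
    convert this using 1; abel
  · rintro ⟨d, hd, h⟩
    refine ⟨d, hd, ?_⟩
    have := add_mem hγ h
    convert this using 1; abel

theorem add_mem_E_iff_of_lt {n k : ℕ} (hk : k < n) {γ : V} (hγ : γ ∈ T.Λ n) (v : V) :
    γ + v ∈ T.E k ↔ v ∈ T.E k := T.add_mem_E_iff (T.antitone hk hγ) v

theorem le_level_add_iff {n : ℕ} {γ : V} (hγ : γ ∈ T.Λ n) (v : V) :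
    n ≤ T.level (γ + v) ↔ n ≤ T.level v := by
  rw [le_level_iff, le_level_iff]
  exact forall₂_congr fun k hk => not_congr (T.add_mem_E_iff_of_lt hk hγ v)

/-- A level below `n` is decided by the sets `E k` with `k < n`, all of which are `Λ n`-periodic.
This makes the filled part of the array periodic. -/
theorem level_add_of_lt {n : ℕ} {γ : V} (hγ : γ ∈ T.Λ n) {v : V} (hv : T.level v < n) :
    T.level (γ + v) = T.level v := by
  have h1 : T.level (γ + v) < n := by
    by_contra! h
    exact absurd ((T.le_level_add_iff hγ v).1 h) (by omega)
  apply le_antisymm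
  · exact T.level_le_iff.2 ⟨_, le_rfl, (T.add_mem_E_iff_of_lt hv hγ v).2 (T.mem_E_level v)⟩
  · exact T.level_le_iff.2 ⟨_, le_rfl, (T.add_mem_E_iff_of_lt h1 hγ v).1 (T.mem_E_level _)⟩

/-- For `k ≥ n` the box `B k`, and with it `E k`, is a union of whole translates of `B n` by `Λ n`,
so membership only sees which translate a point is in. -/
theorem add_mem_E_iff_of_le {n k : ℕ} (hk : n ≤ k) {γ d : V} (hγ : γ ∈ T.Λ n) (hd : d ∈ T.B n) :
    γ + d ∈ T.E k ↔ γ ∈ T.E k := by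
  constructor
  · rintro ⟨b, hb, h⟩
    obtain ⟨d₁, hd₁, h₁⟩ := T.exists_rep n b
    have h2 : d - d₁ ∈ T.Λ n := by
      have := add_mem (sub_mem (T.antitone (hk.trans k.le_succ) h) hγ) h₁
      convert this using 1; abel
    obtain rfl := T.unique n _ hd _ hd₁ h2
    refine ⟨b - d, ?_, ?_⟩
    · rw [← T.tile_le hk h₁ hd]; simpa using hb
    · convert h using 1; abel
  · rintro ⟨b, hb, h⟩
    have hb' : b ∈ T.Λ n := by
      have := sub_mem hγ (T.antitone (hk.trans k.le_succ) h)
      simpa using this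
    refine ⟨b + d, (T.tile_le hk hb' hd).2 hb, ?_⟩
    convert h using 1; abel

/-- Reason for the finite number of blocks: all gaps left in one translate of `B n` are filled at
the same later step. -/
theorem level_add_congr {n : ℕ} {γ d d' : V} (hγ : γ ∈ T.Λ n) (hd : d ∈ T.B n) (hd' : d' ∈ T.B n)
    (h : n ≤ T.level d) (h' : n ≤ T.level d') : T.level (γ + d) = T.level (γ + d') := by
  apply T.level_eq_of_iff
  intro k
  rcases lt_or_ge k n with hk | hk
  · rw [T.add_mem_E_iff_of_lt hk hγ, T.add_mem_E_iff_of_lt hk hγ]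
    exact iff_of_false (T.le_level_iff.1 h k hk) (T.le_level_iff.1 h' k hk)
  · rw [T.add_mem_E_iff_of_le hk hγ hd, T.add_mem_E_iff_of_le hk hγ hd']

/-! ### Counting -/

theorem card_pos (n : ℕ) : 0 < (T.B n).card := Finset.card_pos.2 ⟨0, T.zero_mem n⟩

open Classical in
/-- The translation vectors of the copies of `B n` that tile `B (n + 1)`. -/
noncomputable def tiles (n : ℕ) : Finset V := {γ ∈ T.B (n + 1) | γ ∈ T.Λ n}

theorem sum_succ {M : Type*} [AddCommMonoid M] (n : ℕ) (F : V → M) :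
    ∑ v ∈ T.B (n + 1), F v = ∑ γ ∈ T.tiles n, ∑ d ∈ T.B n, F (γ + d) := by
  classical
  rw [← Finset.sum_product']
  symm
  refine Finset.sum_bij (fun x _ => x.1 + x.2) ?_ ?_ ?_ ?_
  · rintro ⟨γ, d⟩ h
    simp only [tiles, Finset.mem_product, Finset.mem_filter] at h
    exact (T.tile n _ h.1.2 _ h.2).2 h.1.1
  · rintro ⟨γ, d⟩ h ⟨γ', d'⟩ h' he
    simp only [tiles, Finset.mem_product, Finset.mem_filter] at h h' he
    have hd : d = d' := by
      refine T.unique n _ h.2 _ h'.2 ?_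
      have := sub_mem h'.1.2 h.1.2
      have e : d = γ' + d' - γ := by rw [← he]; abel
      rw [e]; convert this using 1; abel
    subst hd
    simpa using he
  · intro v hv
    obtain ⟨d, hd, h⟩ := T.exists_rep n v
    refine ⟨(v - d, d), ?_, by simp⟩
    simp only [tiles, Finset.mem_product, Finset.mem_filter]
    refine ⟨⟨?_, h⟩, hd⟩
    rw [← T.tile n _ h _ hd]; simpa using hv
  · intros; rfl

theorem card_succ (n : ℕ) : (T.B (n + 1)).card = (T.tiles n).card * (T.B n).card := by
  have := T.sum_succ n (fun _ => (1 : ℕ))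
  simpa using this

theorem zero_mem_tiles (n : ℕ) : (0 : V) ∈ T.tiles n := by
  simp [tiles, T.zero_mem, (T.Λ n).zero_mem]

open Classical in
/-- The proportion of the box `B n` that is not yet filled before step `n`. -/
noncomputable def gap (n : ℕ) : ℝ :=
  (((T.B n).filter fun d => n ≤ T.level d).card : ℝ) / (T.B n).card

/-- Among the tiles of `B (n + 1)`, step `n` fills the central one `γ = 0` entirely and leaves the
gaps of the others untouched. -/
theorem succ_le_level_add_iff {n : ℕ} {γ d : V} (hγ : γ ∈ T.tiles n) (hd : d ∈ T.B n) :
    n + 1 ≤ T.level (γ + d) ↔ γ ≠ 0 ∧ n ≤ T.level d := by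
  classical
  simp only [tiles, Finset.mem_filter] at hγ
  have h1 : n + 1 ≤ T.level (γ + d) ↔ n ≤ T.level (γ + d) ∧ γ + d ∉ T.E n := by
    rw [le_level_iff, le_level_iff]
    constructor
    · exact fun h => ⟨fun k hk => h k (by omega), h n (by omega)⟩
    · rintro ⟨h, h'⟩ k hk
      rcases Nat.lt_succ_iff_lt_or_eq.1 hk with hk | rfl
      exacts [h k hk, h']
  rw [h1, T.le_level_add_iff hγ.2, T.add_mem_E_iff_of_le le_rfl hγ.2 hd, and_comm]
  refine and_congr_left fun _ => not_congr ⟨?_, ?_⟩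
  · rintro ⟨b, hb, h⟩
    have hb' : b ∈ T.Λ n := by
      have := sub_mem hγ.2 (T.anti n h)
      simpa using this
    have := T.unique n b hb 0 (T.zero_mem n) (by simpa using hb')
    subst this
    exact T.unique (n + 1) _ hγ.1 0 (T.zero_mem _) (by simpa using h)
  · rintro rfl
    exact ⟨0, T.zero_mem n, by simp⟩

theorem gap_zero : T.gap 0 = 1 := by
  have := T.card_pos 0
  simp only [gap, zero_le, Finset.filter_true]
  field_simp

/-- One tile out of `|B (n+1)| / |B n|` loses its gaps; the others keep the proportion `gap n`. -/
theorem gap_succ (n : ℕ) :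
    T.gap (n + 1) = T.gap n * (1 - ((T.B n).card : ℝ) / (T.B (n + 1)).card) := by
  classical
  have h : ((T.B (n + 1)).filter fun d => n + 1 ≤ T.level d).card =
      ((T.tiles n).card - 1) * ((T.B n).filter fun d => n ≤ T.level d).card := by
    rw [Finset.card_filter, T.sum_succ]
    have : ∀ γ ∈ T.tiles n, ∑ d ∈ T.B n, (if n + 1 ≤ T.level (γ + d) then 1 else 0) =
        if γ ≠ 0 then ((T.B n).filter fun d => n ≤ T.level d).card else 0 := by
      intro γ hγ
      rw [Finset.card_filter]
      split_ifs with h0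
      · exact Finset.sum_congr rfl fun d hd => by
          simp [T.succ_le_level_add_iff hγ hd, h0]
      · exact Finset.sum_eq_zero fun d hd => by
          simp [T.succ_le_level_add_iff hγ hd, h0]
    rw [Finset.sum_congr rfl this, ← Finset.sum_filter, Finset.sum_const, smul_eq_mul,
      Finset.filter_ne', Finset.card_erase_of_mem (T.zero_mem_tiles n)]
  have hk : 1 ≤ (T.tiles n).card := Finset.card_pos.2 ⟨0, T.zero_mem_tiles n⟩
  have hk' : ((T.tiles n).card : ℝ) ≠ 0 := by positivity
  have hB : ((T.B n).card : ℝ) ≠ 0 := by have := T.card_pos n; positivity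
  rw [gap, gap, h, T.card_succ]
  push_cast [Nat.cast_sub hk]
  field_simp

theorem gap_eq_prod (n : ℕ) :
    T.gap n = ∏ i ∈ Finset.range n, (1 - ((T.B i).card : ℝ) / (T.B (i + 1)).card) := by
  induction n with
  | zero => simp [T.gap_zero]
  | succ n ih => rw [T.gap_succ, ih, Finset.prod_range_succ]

theorem exists_tendsto_gap : ∃ δ : ℝ, 0 < δ ∧ Tendsto T.gap atTop (𝓝 δ) := by
  obtain ⟨c, hc, h⟩ := T.prod_bound
  have hb : ∀ n, c ≤ T.gap n := fun n => (h n).trans_eq (T.gap_eq_prod n).symm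
  have ha : Antitone T.gap := by
    refine antitone_nat_of_succ_le fun n => ?_
    rw [T.gap_succ]
    refine mul_le_of_le_one_right (hc.le.trans (hb n)) ?_
    have : (0 : ℝ) ≤ ((T.B n).card : ℝ) / (T.B (n + 1)).card := by positivity
    linarith
  have hbdd : BddBelow (range T.gap) := ⟨c, by rintro _ ⟨n, rfl⟩; exact hb n⟩
  exact ⟨_, hc.trans_le (le_ciInf hb), tendsto_atTop_ciInf ha hbdd⟩

theorem gap_pos (n : ℕ) : 0 < T.gap n := by
  obtain ⟨c, hc, h⟩ := T.prod_bound
  exact hc.trans_le ((h n).trans_eq (T.gap_eq_prod n).symm)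

/-- The gap proportion is positive, and a gap of `B n` itself has level exactly `n` because `B n ⊆ E
n`. -/
theorem exists_level_eq (n : ℕ) : ∃ d ∈ T.B n, T.level d = n := by
  classical
  have h := T.gap_pos n
  by_contra! hne
  have : (T.B n).filter (fun d => n ≤ T.level d) = ∅ := by
    rw [Finset.filter_eq_empty_iff]
    intro d hd hn
    exact hne d hd (le_antisymm (T.level_le hd) hn)
  simp [gap, this] at h

/-- Take a point of level `k` and the translate of `B n` containing it: that point is a gap there,
so all gaps of this translate share its level. Hence every later step fills the gaps of some
translate. -/
theorem exists_level_add_eq {n k : ℕ} (h : n ≤ k) :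
    ∃ γ ∈ T.Λ n, ∀ d ∈ T.B n, n ≤ T.level d → T.level (γ + d) = k := by
  obtain ⟨v, -, hv⟩ := T.exists_level_eq k
  obtain ⟨d, hd, hγ⟩ := T.exists_rep n v
  refine ⟨v - d, hγ, fun d' hd' hl => ?_⟩
  have e : v - d + d = v := by abel
  rw [T.level_add_congr hγ hd' hd hl, e, hv]
  rw [← T.le_level_add_iff hγ, e, hv]
  exact h

open Classical in
/-- The average over `B n` of a weight depending on the level, restricted to the levels `< n`. -/
noncomputable def filled (w : ℕ → ℝ) (n : ℕ) : ℝ :=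
  (∑ d ∈ T.B n, if T.level d < n then w (T.level d) else 0) / (T.B n).card

/-- Filled points keep their level in every tile of the next box, and newly filled points add a
nonnegative amount. -/
theorem filled_le_succ {w : ℕ → ℝ} (hw : ∀ k, 0 ≤ w k) (n : ℕ) :
    T.filled w n ≤ T.filled w (n + 1) := by
  classical
  have hk : (0 : ℝ) < (T.tiles n).card :=
    Nat.cast_pos.2 (Finset.card_pos.2 ⟨0, T.zero_mem_tiles n⟩)
  have hB : (0 : ℝ) < (T.B n).card := Nat.cast_pos.2 (T.card_pos n)
  rw [filled, filled, T.card_succ, T.sum_succ, Nat.cast_mul, div_le_div_iff₀ hB (by positivity)]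
  have : (T.tiles n).card * (∑ d ∈ T.B n, if T.level d < n then w (T.level d) else 0) ≤
      ∑ γ ∈ T.tiles n, ∑ d ∈ T.B n,
        if T.level (γ + d) < n + 1 then w (T.level (γ + d)) else 0 := by
    rw [← nsmul_eq_mul]
    refine Finset.card_nsmul_le_sum _ _ _ fun γ hγ => Finset.sum_le_sum fun d _ => ?_
    split_ifs with h1 h2 h2
    · rw [T.level_add_of_lt (Finset.mem_filter.1 hγ).2 h1]
    · rw [T.level_add_of_lt (Finset.mem_filter.1 hγ).2 h1] at h2
      omega
    · exact hw _
    · exact le_rfl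
  nlinarith

theorem filled_le_one {w : ℕ → ℝ} (hw1 : ∀ k, w k ≤ 1) (n : ℕ) :
    T.filled w n ≤ 1 := by
  have hB : (0 : ℝ) < (T.B n).card := Nat.cast_pos.2 (T.card_pos n)
  rw [filled, div_le_one hB]
  refine (Finset.sum_le_card_nsmul _ _ 1 fun d _ => ?_).trans (by simp)
  split_ifs
  exacts [hw1 _, zero_le_one]

theorem exists_tendsto_filled {w : ℕ → ℝ} (hw : ∀ k, 0 ≤ w k) (hw1 : ∀ k, w k ≤ 1) :
    ∃ s, 0 ≤ s ∧ Tendsto (T.filled w) atTop (𝓝 s) := by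
  have hm : Monotone (T.filled w) := monotone_nat_of_le_succ (T.filled_le_succ hw)
  have hbdd : BddAbove (range (T.filled w)) :=
    ⟨1, by rintro _ ⟨n, rfl⟩; exact T.filled_le_one hw1 n⟩
  refine ⟨_, ?_, tendsto_atTop_ciSup hm hbdd⟩
  refine le_ciSup_of_le hbdd 0 ?_
  simp [filled]

end BoxTower

end VirtToeplitz

namespace VirtToeplitz

/-! ### The group side: cosets, Følner boundary, blocks and averages. -/

/-- A group `G` with a box tower on a subgroup isomorphic to `V`, and a finite set `R` of
representatives of the cosets of this subgroup. -/
structure TiledGroup (G V : Type*) [Group G] [AddCommGroup V] extends BoxTower V where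
  emb : V → G
  emb_add : ∀ v w, emb (v + w) = emb v * emb w
  R : Finset G
  one_mem : (1 : G) ∈ R
  coord : G → V
  rep : G → G
  rep_mem : ∀ g, rep g ∈ R
  emb_mul_rep : ∀ g, emb (coord g) * rep g = g
  coord_emb_mul : ∀ v, ∀ r ∈ R, coord (emb v * r) = v
  rep_emb_mul : ∀ v, ∀ r ∈ R, rep (emb v * r) = r

open Classical in
/-- The symbol at `v * r` when `v` is filled at step `k`. -/
noncomputable def levelSymbol {G : Type*} [Group G] (m : ℕ) [NeZero m] (k : ℕ) (r : G) :
    Fin (m + 1) :=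
  if k = 0 ∧ r ≠ 1 then Fin.last m else alphaSucc m k

namespace TiledGroup

open Classical

variable {G V : Type*} [Group G] [AddCommGroup V] (F : TiledGroup G V)

theorem emb_zero : F.emb 0 = 1 := by
  have := F.emb_add 0 0
  rw [add_zero] at this
  exact left_eq_mul.1 this

theorem emb_neg (v : V) : F.emb (-v) = (F.emb v)⁻¹ := by
  rw [eq_inv_iff_mul_eq_one, ← F.emb_add, neg_add_cancel, F.emb_zero]

theorem coord_emb_mul' (v : V) (g : G) : F.coord (F.emb v * g) = v + F.coord g := by
  conv_lhs => rw [← F.emb_mul_rep g, ← mul_assoc, ← F.emb_add]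
  exact F.coord_emb_mul _ _ (F.rep_mem g)

theorem rep_emb_mul' (v : V) (g : G) : F.rep (F.emb v * g) = F.rep g := by
  conv_lhs => rw [← F.emb_mul_rep g, ← mul_assoc, ← F.emb_add]
  exact F.rep_emb_mul _ _ (F.rep_mem g)

theorem coord_of_mem {r : G} (hr : r ∈ F.R) : F.coord r = 0 := by
  have := F.coord_emb_mul 0 r hr
  rwa [F.emb_zero, one_mul] at this

theorem rep_of_mem {r : G} (hr : r ∈ F.R) : F.rep r = r := by
  have := F.rep_emb_mul 0 r hr
  rwa [F.emb_zero, one_mul] at this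

/-- The finite set `B n * R`. -/
noncomputable def U (n : ℕ) : Finset G := (F.B n ×ˢ F.R).image fun x => F.emb x.1 * x.2

theorem injOn_emb_mul (n : ℕ) :
    InjOn (fun x : V × G => F.emb x.1 * x.2) (F.B n ×ˢ F.R : Finset (V × G)) := by
  rintro ⟨d, r⟩ h ⟨d', r'⟩ h' he
  simp only [Finset.coe_product, mem_prod, Finset.mem_coe] at h h' he
  have h1 := F.coord_emb_mul d r h.2
  have h2 := F.rep_emb_mul d r h.2
  rw [he, F.coord_emb_mul d' r' h'.2] at h1
  rw [he, F.rep_emb_mul d' r' h'.2] at h2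
  rw [h1, h2]

theorem mem_U {n : ℕ} {g : G} : g ∈ F.U n ↔ F.coord g ∈ F.B n := by
  constructor
  · intro h
    obtain ⟨⟨d, r⟩, hx, rfl⟩ := Finset.mem_image.1 h
    rw [Finset.mem_product] at hx
    rw [F.coord_emb_mul _ _ hx.2]
    exact hx.1
  · intro h
    exact Finset.mem_image.2
      ⟨(F.coord g, F.rep g), Finset.mem_product.2 ⟨h, F.rep_mem g⟩, F.emb_mul_rep g⟩

theorem one_mem_U (n : ℕ) : (1 : G) ∈ F.U n := by
  rw [mem_U, F.coord_of_mem F.one_mem]; exact F.zero_mem n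

theorem sum_U {M : Type*} [AddCommMonoid M] (n : ℕ) (f : G → M) :
    ∑ u ∈ F.U n, f u = ∑ d ∈ F.B n, ∑ r ∈ F.R, f (F.emb d * r) := by
  rw [U, Finset.sum_image (F.injOn_emb_mul n), Finset.sum_product]

theorem card_U (n : ℕ) : (F.U n).card = (F.B n).card * F.R.card := by
  rw [U, Finset.card_image_of_injOn (F.injOn_emb_mul n), Finset.card_product]

theorem card_U_pos (n : ℕ) : (0 : ℝ) < (F.U n).card :=
  Nat.cast_pos.2 (Finset.card_pos.2 ⟨1, F.one_mem_U n⟩)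

theorem card_R_pos : (0 : ℝ) < F.R.card :=
  Nat.cast_pos.2 (Finset.card_pos.2 ⟨1, F.one_mem⟩)

/-- The representative in `U n` of the right coset of `g` modulo `emb (Λ n)`. -/
noncomputable def reduce (n : ℕ) (g : G) : G :=
  F.emb (F.exists_rep n (F.coord g)).choose * F.rep g

theorem reduce_mem (n : ℕ) (g : G) : F.reduce n g ∈ F.U n := by
  rw [mem_U, reduce, F.coord_emb_mul _ _ (F.rep_mem g)]
  exact (F.exists_rep n (F.coord g)).choose_spec.1

theorem exists_emb_mul_reduce (n : ℕ) (g : G) : ∃ γ ∈ F.Λ n, F.emb γ * F.reduce n g = g := by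
  refine ⟨_, (F.exists_rep n (F.coord g)).choose_spec.2, ?_⟩
  rw [reduce, ← mul_assoc, ← F.emb_add, sub_add_cancel, F.emb_mul_rep]

theorem eq_of_emb_mul_eq {n : ℕ} {γ : V} (hγ : γ ∈ F.Λ n) {u u' : G} (hu : u ∈ F.U n)
    (hu' : u' ∈ F.U n) (h : F.emb γ * u = u') : γ = 0 ∧ u = u' := by
  rw [mem_U] at hu hu'
  have h1 := F.coord_emb_mul' γ u
  rw [h] at h1
  have h2 := F.unique n _ hu' _ hu (by rw [h1]; simpa using hγ)
  have h3 : γ = 0 := by rw [h2] at h1; simpa using h1.symm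
  refine ⟨h3, ?_⟩
  rw [← h, h3, F.emb_zero, one_mul]

theorem reduce_of_mem {n : ℕ} {g : G} (hg : g ∈ F.U n) : F.reduce n g = g := by
  obtain ⟨γ, hγ, h⟩ := F.exists_emb_mul_reduce n g
  exact (F.eq_of_emb_mul_eq hγ (F.reduce_mem n g) hg h).2

/-- Right multiplication by `h` permutes the cosets `emb (Λ n) g`, of which `U n` is a set of
representatives. No normality of `emb (Λ n)` in `G` is involved. -/
theorem sum_reduce_mul {M : Type*} [AddCommMonoid M] (n : ℕ) (h : G) (f : G → M) :
    ∑ u ∈ F.U n, f (F.reduce n (u * h)) = ∑ u ∈ F.U n, f u := by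
  have hinj : Set.InjOn (fun u => F.reduce n (u * h)) (F.U n) := by
    intro u hu u' hu' he
    obtain ⟨γ, hγ, e⟩ := F.exists_emb_mul_reduce n (u * h)
    obtain ⟨γ', hγ', e'⟩ := F.exists_emb_mul_reduce n (u' * h)
    simp only at he
    have : F.emb (γ' - γ) * u = u' := by
      rw [← mul_left_inj h, mul_assoc, ← e, ← e', ← mul_assoc, ← F.emb_add, he, sub_add_cancel]
    exact (F.eq_of_emb_mul_eq (sub_mem hγ' hγ) hu hu' this).2
  have him : (F.U n).image (fun u => F.reduce n (u * h)) = F.U n := by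
    refine Finset.eq_of_subset_of_card_le ?_ (Finset.card_image_of_injOn hinj).ge
    intro u hu
    obtain ⟨u', -, rfl⟩ := Finset.mem_image.1 hu
    exact F.reduce_mem _ _
  conv_rhs => rw [← him, Finset.sum_image hinj]

theorem sum_mul_of_periodic {M : Type*} [AddCommMonoid M] (n : ℕ) (h : G) (f : G → M)
    (hf : ∀ γ ∈ F.Λ n, ∀ g, f (F.emb γ * g) = f g) :
    ∑ u ∈ F.U n, f (u * h) = ∑ u ∈ F.U n, f u := by
  rw [← F.sum_reduce_mul n h f]
  refine Finset.sum_congr rfl fun u _ => ?_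
  obtain ⟨γ, hγ, e⟩ := F.exists_emb_mul_reduce n (u * h)
  rw [← hf γ hγ (F.reduce n (u * h)), e]

/-! ### Boundary -/

/-- The proportion of the points `u` of `U n` for which `u * W` is not contained in `U n`. -/
noncomputable def boundary (W : Finset G) (n : ℕ) : ℝ :=
  ((F.U n).filter fun u => ∃ w ∈ W, u * w ∉ F.U n).card / (F.U n).card

/-- For `u = emb d * r` one has `coord (u * w) = d + coord (r * w)`, so leaving `U n` amounts to `B
n` being left under one of the finitely many vectors `coord (r * w)`. -/
theorem tendsto_boundary (W : Finset G) : Tendsto (F.boundary W) atTop (𝓝 0) := by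
  have hlim : Tendsto (fun n => ∑ w ∈ W, ∑ r ∈ F.R,
      (({d ∈ (F.B n : Set V) | d + F.coord (r * w) ∉ F.B n}).ncard : ℝ) / (F.B n).card)
      atTop (𝓝 0) := by
    have := tendsto_finsetSum W fun w _ => tendsto_finsetSum F.R fun r _ =>
      F.folner (F.coord (r * w))
    simpa using this
  refine squeeze_zero (fun n => by unfold boundary; positivity) (fun n => ?_) hlim
  have hB : (0 : ℝ) < (F.B n).card := Nat.cast_pos.2 (F.card_pos n)
  simp_rw [← Finset.sum_div]
  rw [boundary, F.card_U, Nat.cast_mul]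
  have h1 : (1 : ℝ) ≤ F.R.card := Nat.one_le_cast.2 (Finset.card_pos.2 ⟨1, F.one_mem⟩)
  have h2 : (((F.U n).filter fun u => ∃ w ∈ W, u * w ∉ F.U n).card : ℝ) ≤ ∑ w ∈ W, ∑ r ∈ F.R,
      ((({d ∈ (F.B n : Set V) | d + F.coord (r * w) ∉ F.B n}).ncard : ℕ) : ℝ) := by
    have : (F.U n).filter (fun u => ∃ w ∈ W, u * w ∉ F.U n) =
        W.biUnion fun w => (F.U n).filter fun u => u * w ∉ F.U n := by
      ext u; simp only [Finset.mem_filter, Finset.mem_biUnion]; tauto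
    rw [this]
    refine (Nat.cast_le.2 Finset.card_biUnion_le).trans ?_
    rw [Nat.cast_sum]
    refine Finset.sum_le_sum fun w _ => ?_
    rw [Finset.card_filter, F.sum_U, Finset.sum_comm]
    push_cast
    refine Finset.sum_le_sum fun r _ => le_of_eq ?_
    have e : {d ∈ (F.B n : Set V) | d + F.coord (r * w) ∉ F.B n} =
        ((F.B n).filter fun d => d + F.coord (r * w) ∉ F.B n : Finset V) := by
      ext; simp
    rw [e, Set.ncard_coe_finset, Finset.card_filter]
    push_cast
    refine Finset.sum_congr rfl fun d _ => ?_
    simp only [F.mem_U, mul_assoc, F.coord_emb_mul']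
  refine div_le_div₀ (by positivity) h2 hB ?_
  nlinarith

/-! ### The array and its blocks -/

variable (m : ℕ) [NeZero m]

/-- The array whose value at `v * r` is determined by the level of `v`. -/
noncomputable def array (g : G) : Fin (m + 1) := levelSymbol m (F.level (F.coord g)) (F.rep g)

variable {m}

/-- The block on `U n` with the periodic content of level `n` and the symbol `a` in the gaps. -/
noncomputable def block (n : ℕ) (a : Fin m) (g : G) : Fin (m + 1) :=
  if F.level (F.coord g) < n then F.array m g else a.castSucc

/-- The configuration `z` shows the block of type `a` on `U n`. -/
def HasType (n : ℕ) (a : Fin m) (z : G → Fin (m + 1)) : Prop := ∀ u ∈ F.U n, z u = F.block n a u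

/-- The gaps of the translate all have level `k ≥ n ≥ 1`, where the symbol no longer depends on the
representative; only level `0` produces `β`. -/
theorem array_hasType {n : ℕ} (hn : 1 ≤ n) {γ : V} (hγ : γ ∈ F.Λ n) (k : ℕ)
    (hk : ∀ d ∈ F.B n, n ≤ F.level d → F.level (γ + d) = k) :
    F.HasType n (Fin.ofNat m k) (shift (F.emb γ)⁻¹ (F.array m)) := by
  intro u hu
  rw [mem_U] at hu
  simp only [shift, inv_inv, block, array, coord_emb_mul', rep_emb_mul']
  split_ifs with h
  · rw [F.level_add_of_lt hγ h]
  · have h1 := hk _ hu (not_lt.1 h)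
    have h2 := (F.le_level_add_iff hγ (F.coord u)).2 (not_lt.1 h)
    rw [h1] at h2 ⊢
    rw [levelSymbol, if_neg (by omega), alphaSucc]

theorem exists_hasType_array {n : ℕ} (hn : 1 ≤ n) {γ : V} (hγ : γ ∈ F.Λ n) :
    ∃ a : Fin m, F.HasType n a (shift (F.emb γ)⁻¹ (F.array m)) := by
  obtain ⟨d, hd, hl⟩ := F.exists_level_eq n
  exact ⟨_, F.array_hasType hn hγ _ fun d' hd' hl' => F.level_add_congr hγ hd' hd hl' hl.ge⟩

theorem hasType_array {n : ℕ} (hn : 1 ≤ n) : F.HasType n (Fin.ofNat m n) (F.array m) := by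
  have := F.array_hasType (m := m) hn (F.Λ n).zero_mem n fun d hd hl => by
    rw [zero_add]; exact le_antisymm (F.level_le hd) hl
  simpa [shift, F.emb_zero, HasType] using this

theorem exists_shift_hasType {n : ℕ} (hn : 1 ≤ n) (a : Fin m) :
    ∃ g, F.HasType n a (shift g (F.array m)) := by
  -- The level `a + n * m` is at least `n` and congruent to `a` modulo `m`.
  obtain ⟨γ, hγ, h⟩ := F.exists_level_add_eq (n := n) (k := a + n * m)
    (le_add_left (Nat.le_mul_of_pos_right _ (NeZero.pos m)))
  refine ⟨(F.emb γ)⁻¹, ?_⟩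
  convert F.array_hasType hn hγ _ h
  ext
  simp [Nat.mod_eq_of_lt a.2]

/-- Every translate of `U n` by `emb (Λ n)` carries a block. -/
def Aligned (m n : ℕ) [NeZero m] (z : G → Fin (m + 1)) : Prop :=
  ∀ γ ∈ F.Λ n, ∃ a : Fin m, F.HasType n a (shift (F.emb γ)⁻¹ z)

theorem aligned_array {n : ℕ} (hn : 1 ≤ n) : F.Aligned m n (F.array m) := fun _ hγ =>
  F.exists_hasType_array hn hγ

theorem shift_shift {A : Type*} (g h : G) (x : G → A) : shift g (shift h x) = shift (g * h) x := by
  funext k; simp [shift, mul_assoc]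

theorem shift_one {A : Type*} (x : G → A) : shift (1 : G) x = x := by
  funext k; simp [shift]

theorem Aligned.shift_emb {n : ℕ} {z : G → Fin (m + 1)} (h : F.Aligned m n z) {γ : V}
    (hγ : γ ∈ F.Λ n) : F.Aligned m n (shift (F.emb γ) z) := by
  intro γ' hγ'
  rw [shift_shift, ← F.emb_neg, ← F.emb_add]
  obtain ⟨a, ha⟩ := h (γ' - γ) (sub_mem hγ' hγ)
  refine ⟨a, ?_⟩
  convert ha using 2
  rw [← F.emb_neg]
  congr 1; abel

theorem aligned_shift_emb_iff {n : ℕ} {z : G → Fin (m + 1)} {γ : V} (hγ : γ ∈ F.Λ n) :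
    F.Aligned m n (shift (F.emb γ) z) ↔ F.Aligned m n z := by
  refine ⟨fun h => ?_, fun h => h.shift_emb F hγ⟩
  have := h.shift_emb F (neg_mem hγ)
  rwa [shift_shift, ← F.emb_add, neg_add_cancel, F.emb_zero, shift_one] at this

theorem Aligned.exists_hasType {n : ℕ} {z : G → Fin (m + 1)} (h : F.Aligned m n z) :
    ∃ a : Fin m, F.HasType n a z := by
  obtain ⟨a, ha⟩ := h 0 (F.Λ n).zero_mem
  refine ⟨a, ?_⟩
  simpa [F.emb_zero, shift_one] using ha

theorem isClosed_hasType (n : ℕ) (a : Fin m) : IsClosed {z | F.HasType n a z} := by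
  simp only [HasType, ofPred_forall]
  exact isClosed_biInter fun u _ => isClosed_eq (continuous_apply u) continuous_const

theorem continuous_shift {A : Type*} [TopologicalSpace A] (g : G) :
    Continuous (shift g : (G → A) → G → A) :=
  continuous_pi fun h => continuous_apply (g⁻¹ * h)

theorem isClosed_aligned (n : ℕ) : IsClosed {z | F.Aligned m n z} := by
  simp only [Aligned, ofPred_forall, ofPred_exists]
  exact isClosed_biInter fun γ _ => isClosed_iUnion_of_finite fun a =>
    (F.isClosed_hasType n a).preimage (continuous_shift _)

/-- The condition is a finite union of closed sets, so it need only be checked on the orbit: for a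
shift by `g`, the representative `u` of `g⁻¹` makes `u * g` an element of `emb (Λ n)`. -/
theorem exists_aligned_shift {n : ℕ} (hn : 1 ≤ n) {y : G → Fin (m + 1)}
    (hy : y ∈ orbitClosure (F.array m)) : ∃ u ∈ F.U n, F.Aligned m n (shift u y) := by
  have hc : IsClosed {y | ∃ u ∈ F.U n, F.Aligned m n (shift u y)} := by
    have : {y | ∃ u ∈ F.U n, F.Aligned m n (shift u y)} =
        ⋃ u ∈ F.U n, shift u ⁻¹' {z | F.Aligned m n z} := by
      ext; simp
    rw [this]
    exact isClosed_biUnion_finset fun u _ => (F.isClosed_aligned n).preimage (continuous_shift _)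
  refine closure_minimal ?_ hc hy
  rintro _ ⟨g, rfl⟩
  obtain ⟨γ, hγ, e⟩ := F.exists_emb_mul_reduce n g⁻¹
  refine ⟨F.reduce n g⁻¹, F.reduce_mem _ _, ?_⟩
  rw [shift_shift]
  have : F.reduce n g⁻¹ * g = F.emb (-γ) := by
    rw [F.emb_neg, eq_comm, inv_eq_iff_mul_eq_one, ← mul_assoc, e, inv_mul_cancel]
  rw [this, F.aligned_shift_emb_iff (neg_mem hγ)]
  exact F.aligned_array hn

/-! ### Averages -/

/-- The average of `f` along the translates of `z` indexed by `U n`. -/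
noncomputable def avg (n : ℕ) (f : (G → Fin (m + 1)) → ℝ) (z : G → Fin (m + 1)) : ℝ :=
  (∑ u ∈ F.U n, f (shift u⁻¹ z)) / (F.U n).card

-- When `u * W ⊆ U n`, the two translates agree on `W`; the remaining `u` are counted by the
-- boundary and cost at most `2 * C` each.
omit [NeZero m] in
theorem abs_avg_sub_le (n : ℕ) {f : (G → Fin (m + 1)) → ℝ} {C ε : ℝ} {W : Finset G}
    (hf : ∀ x, |f x| ≤ C) (hW : ∀ x y, (∀ w ∈ W, x w = y w) → |f x - f y| ≤ ε)
    {z z' : G → Fin (m + 1)} (h : ∀ u ∈ F.U n, z u = z' u) :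
    |F.avg n f z - F.avg n f z'| ≤ ε + 2 * C * F.boundary W n := by
  have hε : 0 ≤ ε := (abs_nonneg _).trans (hW z z fun _ _ => rfl)
  have hU := F.card_U_pos n
  rw [avg, avg, ← sub_div, abs_div, abs_of_pos hU, div_le_iff₀ hU, ← Finset.sum_sub_distrib]
  refine (Finset.abs_sum_le_sum_abs _ _).trans ?_
  have hterm : ∀ u ∈ F.U n, |f (shift u⁻¹ z) - f (shift u⁻¹ z')| ≤
      ε + 2 * C * (if ∃ w ∈ W, u * w ∉ F.U n then 1 else 0 : ℕ) := by
    intro u _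
    split_ifs with hu
    · have h1 := abs_le.1 (hf (shift u⁻¹ z))
      have h2 := abs_le.1 (hf (shift u⁻¹ z'))
      rw [abs_le]; push_cast
      constructor <;> linarith
    · push Not at hu
      have := hW (shift u⁻¹ z) (shift u⁻¹ z') fun w hw => by
        simpa [shift] using h _ (hu w hw)
      simpa using this
  refine (Finset.sum_le_sum hterm).trans (le_of_eq ?_)
  rw [Finset.sum_add_distrib, ← Finset.mul_sum, ← Nat.cast_sum, ← Finset.card_filter, boundary]
  field_simp
  simp [mul_comm]

-- Applying `shift g` replaces `u` by `u * g⁻¹`, which is a reindexing of `U n` except where `u *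
-- g⁻¹` leaves `U n`.
omit [NeZero m] in
theorem abs_avg_shift_sub_le (n : ℕ) {f : (G → Fin (m + 1)) → ℝ} {C : ℝ}
    (hf : ∀ x, |f x| ≤ C) (g : G) (z : G → Fin (m + 1)) :
    |F.avg n (fun x => f (shift g x)) z - F.avg n f z| ≤ 2 * C * F.boundary {g⁻¹} n := by
  have hU := F.card_U_pos n
  rw [avg, avg, ← F.sum_reduce_mul n g⁻¹ (fun u => f (shift u⁻¹ z)), ← sub_div, abs_div, abs_of_pos hU, div_le_iff₀ hU,
    ← Finset.sum_sub_distrib]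
  refine (Finset.abs_sum_le_sum_abs _ _).trans ?_
  have hterm : ∀ u ∈ F.U n,
      |f (shift g (shift u⁻¹ z)) - f (shift (F.reduce n (u * g⁻¹))⁻¹ z)| ≤
      2 * C * (if ∃ w ∈ ({g⁻¹} : Finset G), u * w ∉ F.U n then 1 else 0 : ℕ) := by
    intro u _
    split_ifs with hu
    · have h1 := abs_le.1 (hf (shift g (shift u⁻¹ z)))
      have h2 := abs_le.1 (hf (shift (F.reduce n (u * g⁻¹))⁻¹ z))
      rw [abs_le]; push_cast
      constructor <;> linarith
    · simp only [Finset.mem_singleton, exists_eq_left, not_not] at hu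
      rw [F.reduce_of_mem hu, shift_shift]
      simp
  refine (Finset.sum_le_sum hterm).trans (le_of_eq ?_)
  rw [← Finset.mul_sum, ← Nat.cast_sum, ← Finset.card_filter, boundary]
  field_simp

/-- The proportion of the positions in `U n` filled before step `n` by the symbol `b`. -/
noncomputable def symbolFreq (m : ℕ) [NeZero m] (b : Fin (m + 1)) (n : ℕ) : ℝ :=
  F.filled (fun k => ((F.R.filter fun r => levelSymbol m k r = b).card : ℝ) / F.R.card) n

theorem symbolFreq_eq (b : Fin (m + 1)) (n : ℕ) : F.symbolFreq m b n =
    ((F.U n).filter fun u => F.level (F.coord u) < n ∧ F.array m u = b).card / (F.U n).card := by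
  have hR := F.card_R_pos
  have hB : (0 : ℝ) < (F.B n).card := Nat.cast_pos.2 (F.card_pos n)
  rw [symbolFreq, BoxTower.filled, Finset.card_filter, F.sum_U, F.card_U, Nat.cast_mul,
    mul_comm, ← div_div]
  congr 1
  rw [eq_div_iff hR.ne', Finset.sum_mul]
  push_cast
  refine Finset.sum_congr rfl fun d _ => ?_
  have : ∀ r ∈ F.R, (if F.level (F.coord (F.emb d * r)) < n ∧ F.array m (F.emb d * r) = b
      then (1 : ℝ) else 0) = if F.level d < n then
        (if levelSymbol m (F.level d) r = b then 1 else 0) else 0 := by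
    intro r hr
    rw [array, F.coord_emb_mul _ _ hr, F.rep_emb_mul _ _ hr]
    split_ifs <;> simp_all
  rw [Finset.sum_congr rfl this]
  split_ifs
  · rw [Finset.card_filter]
    push_cast
    field_simp
  · simp

theorem gap_eq (n : ℕ) :
    F.gap n = ((F.U n).filter fun u => n ≤ F.level (F.coord u)).card / (F.U n).card := by
  have hR := F.card_R_pos
  have hB : (0 : ℝ) < (F.B n).card := Nat.cast_pos.2 (F.card_pos n)
  rw [BoxTower.gap, Finset.card_filter, Finset.card_filter, F.sum_U, F.card_U]
  have : ∀ d ∈ F.B n, ∑ r ∈ F.R, (if n ≤ F.level (F.coord (F.emb d * r)) then 1 else 0) =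
      (if n ≤ F.level d then 1 else 0) * F.R.card := by
    intro d _
    rw [Finset.sum_congr rfl fun r hr => by rw [F.coord_emb_mul _ _ hr]]
    simp
  rw [Finset.sum_congr rfl this, ← Finset.sum_mul]
  push_cast
  field_simp

theorem card_symbol_of_hasType {n : ℕ} {a : Fin m} {z : G → Fin (m + 1)} (h : F.HasType n a z)
    (b : Fin (m + 1)) : (((F.U n).filter fun u => z u = b).card : ℝ) / (F.U n).card =
      F.symbolFreq m b n + if b = a.castSucc then F.gap n else 0 := by
  have : (F.U n).filter (fun u => z u = b) =
      (F.U n).filter (fun u => F.level (F.coord u) < n ∧ F.array m u = b) ∪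
      (F.U n).filter (fun u => n ≤ F.level (F.coord u) ∧ b = a.castSucc) := by
    ext u
    simp only [Finset.mem_filter, Finset.mem_union, ← and_or_left]
    refine and_congr_right fun hu => ?_
    rw [h u hu, block]
    split_ifs with h1
    · simp [h1]
    · simp [h1, not_lt.1 h1, eq_comm]
  rw [this, Finset.card_union_of_disjoint, symbolFreq_eq, gap_eq]
  · split_ifs with hb
    · simp [hb, add_div]
    · simp [hb]
  · rw [Finset.disjoint_filter]
    intro u _ h1 h2
    omega

omit [NeZero m] in
theorem avg_symbol (n : ℕ) (b : Fin (m + 1)) (z : G → Fin (m + 1)) :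
    F.avg n (fun x => if x 1 = b then 1 else 0) z =
      ((F.U n).filter fun u => z u = b).card / (F.U n).card := by
  rw [avg, Finset.card_filter]
  simp [shift]

theorem sum_symbolFreq (n : ℕ) : ∑ b, F.symbolFreq m b n = 1 - F.gap n := by
  rw [eq_sub_iff_add_eq, gap_eq]
  simp_rw [symbolFreq_eq]
  have hU := F.card_U_pos n
  rw [← Finset.sum_div, ← add_div, div_eq_one_iff_eq hU.ne', ← Nat.cast_sum]
  have h1 : ∑ b, ((F.U n).filter fun u => F.level (F.coord u) < n ∧ F.array m u = b).card =
      ((F.U n).filter fun u => F.level (F.coord u) < n).card := by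
    rw [Finset.card_eq_sum_card_fiberwise (f := F.array m) (t := Finset.univ) (by simp)]
    exact Finset.sum_congr rfl fun b _ => by rw [Finset.filter_filter]
  have h2 : ((F.U n).filter fun u => n ≤ F.level (F.coord u)) =
      (F.U n).filter fun u => ¬ F.level (F.coord u) < n :=
    Finset.filter_congr fun u _ => not_lt.symm
  rw [h1, h2, ← Nat.cast_add, Finset.card_filter_add_card_filter_not]

theorem exists_tendsto_symbolFreq (b : Fin (m + 1)) :
    ∃ s, 0 ≤ s ∧ Tendsto (F.symbolFreq m b) atTop (𝓝 s) := by
  refine F.exists_tendsto_filled (fun k => by positivity) fun k => ?_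
  rw [div_le_one F.card_R_pos]
  exact_mod_cast Finset.card_filter_le _ _

end TiledGroup

end VirtToeplitz

namespace VirtToeplitz

/-! ### The action on the orbit closure, and mass transport along alignments. -/

section Subshift

variable {G A : Type*} [Group G] [TopologicalSpace A] {x : G → A}

theorem subshiftAction_mul (g h : G) (y : orbitClosure x) :
    subshiftAction x g (subshiftAction x h y) = subshiftAction x (g * h) y :=
  Subtype.ext (TiledGroup.shift_shift g h y.1)

theorem subshiftAction_one (y : orbitClosure x) : subshiftAction x 1 y = y :=
  Subtype.ext (TiledGroup.shift_one y.1)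

theorem image_subshiftAction (g : G) (S : Set (orbitClosure x)) :
    subshiftAction x g '' S = subshiftAction x g⁻¹ ⁻¹' S := by
  refine congrFun (image_eq_preimage_of_inverse ?_ ?_) S
  · intro y; rw [subshiftAction_mul, inv_mul_cancel, subshiftAction_one]
  · intro y; rw [subshiftAction_mul, mul_inv_cancel, subshiftAction_one]

variable [MeasurableSpace A]

theorem measurable_subshiftAction (g : G) : Measurable (subshiftAction x g) :=
  ((measurable_pi_lambda _ fun h => measurable_pi_apply (g⁻¹ * h)).comp
    measurable_subtype_coe).subtype_mk

theorem isInvariantMeasure_iff {μ : Measure (orbitClosure x)} :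
    IsInvariantMeasure (subshiftAction x) μ ↔
      IsProbabilityMeasure μ ∧ ∀ g, MeasurePreserving (subshiftAction x g) μ μ := by
  refine and_congr_right fun _ => ⟨fun h g => ⟨measurable_subshiftAction g, ?_⟩, fun h g S hS => ?_⟩
  · ext S hS
    rw [Measure.map_apply (measurable_subshiftAction g) hS, ← h g⁻¹ S hS, image_subshiftAction,
      inv_inv]
  · rw [image_subshiftAction, (h g⁻¹).measure_preimage hS.nullMeasurableSet]

end Subshift

theorem integrable_of_abs_le {X : Type*} [MeasurableSpace X] {μ : Measure X} [IsFiniteMeasure μ]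
    {f : X → ℝ} (hf : Measurable f) {C : ℝ} (h : ∀ x, |f x| ≤ C) : Integrable f μ :=
  Integrable.of_bound hf.aestronglyMeasurable C (ae_of_all _ h)

namespace TiledGroup

open Classical

variable {G V : Type*} [Group G] [AddCommGroup V] (F : TiledGroup G V) {m : ℕ} [NeZero m]

/-- The indicator of the configurations that are aligned after a shift by `g`. -/
noncomputable def alignedInd (n : ℕ) (g : G) (y : G → Fin (m + 1)) : ℝ :=
  if F.Aligned m n (shift g y) then 1 else 0

/-- The probability that a uniformly chosen alignment of `y` is given by the shift by `g`. -/
noncomputable def alignedWeight (n : ℕ) (g : G) (y : G → Fin (m + 1)) : ℝ :=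
  F.alignedInd n g y / ∑ u ∈ F.U n, F.alignedInd n u y

theorem alignedInd_shift (n : ℕ) (g h : G) (y : G → Fin (m + 1)) :
    F.alignedInd n g (shift h y) = F.alignedInd n (g * h) y := by
  rw [alignedInd, alignedInd, shift_shift]

/-- Alignment after a shift by `g` depends only on the coset `emb (Λ n) g`, so the number of
alignments is shift invariant. Normalising by this number makes uniqueness of the alignment
unnecessary. -/
theorem sum_alignedInd_shift (n : ℕ) (h : G) (y : G → Fin (m + 1)) :
    ∑ u ∈ F.U n, F.alignedInd n u (shift h y) = ∑ u ∈ F.U n, F.alignedInd n u y := by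
  simp_rw [alignedInd_shift]
  refine F.sum_mul_of_periodic n h (fun g => F.alignedInd n g y) fun γ hγ g => ?_
  rw [alignedInd, alignedInd, ← shift_shift]
  simp only [F.aligned_shift_emb_iff hγ]

theorem alignedWeight_shift (n : ℕ) (g h : G) (y : G → Fin (m + 1)) :
    F.alignedWeight n g (shift h y) = F.alignedWeight n (g * h) y := by
  rw [alignedWeight, alignedWeight, sum_alignedInd_shift, alignedInd_shift]

theorem alignedInd_nonneg (n : ℕ) (g : G) (y : G → Fin (m + 1)) : 0 ≤ F.alignedInd n g y := by
  rw [alignedInd]; split_ifs <;> norm_num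

theorem alignedWeight_nonneg (n : ℕ) (g : G) (y : G → Fin (m + 1)) :
    0 ≤ F.alignedWeight n g y :=
  div_nonneg (F.alignedInd_nonneg n g y) (Finset.sum_nonneg fun _ _ => F.alignedInd_nonneg n _ y)

theorem aligned_of_alignedWeight_ne_zero {n : ℕ} {g : G} {y : G → Fin (m + 1)}
    (h : F.alignedWeight n g y ≠ 0) : F.Aligned m n (shift g y) := by
  by_contra hc
  simp [alignedWeight, alignedInd, hc] at h

theorem sum_alignedWeight {n : ℕ} (hn : 1 ≤ n) {y : G → Fin (m + 1)}
    (hy : y ∈ orbitClosure (F.array m)) : ∑ u ∈ F.U n, F.alignedWeight n u y = 1 := by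
  simp_rw [alignedWeight]
  rw [← Finset.sum_div]
  refine div_self (ne_of_gt ?_)
  obtain ⟨u, hu, h⟩ := F.exists_aligned_shift hn hy
  refine Finset.sum_pos' (fun _ _ => F.alignedInd_nonneg n _ y) ⟨u, hu, ?_⟩
  simp [alignedInd, h]

theorem measurable_shift {A : Type*} [MeasurableSpace A] (g : G) :
    Measurable (shift g : (G → A) → G → A) :=
  measurable_pi_lambda _ fun h => measurable_pi_apply (g⁻¹ * h)

omit [NeZero m] in
theorem measurable_avg (n : ℕ) {f : (G → Fin (m + 1)) → ℝ} (hf : Measurable f) :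
    Measurable (F.avg n f) :=
  (Finset.measurable_fun_sum _ fun u _ => hf.comp (measurable_shift u⁻¹)).div_const _

omit [NeZero m] in
theorem abs_avg_le (n : ℕ) {f : (G → Fin (m + 1)) → ℝ} {C : ℝ} (hf : ∀ x, |f x| ≤ C)
    (z : G → Fin (m + 1)) : |F.avg n f z| ≤ C := by
  have hU := F.card_U_pos n
  rw [avg, abs_div, abs_of_pos hU, div_le_iff₀ hU]
  refine (Finset.abs_sum_le_sum_abs _ _).trans ((Finset.sum_le_sum fun u _ => hf _).trans ?_)
  simp [mul_comm]

/-- The average of `f` over the alignments of `y`. -/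
noncomputable def alignedAvg (n : ℕ) (f : (G → Fin (m + 1)) → ℝ) (y : G → Fin (m + 1)) : ℝ :=
  ∑ u ∈ F.U n, F.alignedWeight n u y * f (shift u y)

theorem abs_alignedAvg_le {n : ℕ} (hn : 1 ≤ n) {f : (G → Fin (m + 1)) → ℝ} {C : ℝ}
    (hf : ∀ z, F.Aligned m n z → |f z| ≤ C) {y : G → Fin (m + 1)}
    (hy : y ∈ orbitClosure (F.array m)) : |F.alignedAvg n f y| ≤ C := by
  calc |F.alignedAvg n f y| ≤ ∑ u ∈ F.U n, |F.alignedWeight n u y * f (shift u y)| :=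
        Finset.abs_sum_le_sum_abs _ _
    _ ≤ ∑ u ∈ F.U n, F.alignedWeight n u y * C := by
        refine Finset.sum_le_sum fun u _ => ?_
        rw [abs_mul, abs_of_nonneg (F.alignedWeight_nonneg n u y)]
        by_cases h : F.alignedWeight n u y = 0
        · simp [h]
        · exact mul_le_mul_of_nonneg_left (hf _ (F.aligned_of_alignedWeight_ne_zero h))
            (F.alignedWeight_nonneg n u y)
    _ = C := by rw [← Finset.sum_mul, F.sum_alignedWeight hn hy, one_mul]

variable [Countable G]

theorem measurable_alignedWeight (n : ℕ) (g : G) :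
    Measurable (F.alignedWeight n g : (G → Fin (m + 1)) → ℝ) := by
  have h : ∀ g, Measurable (F.alignedInd n g : (G → Fin (m + 1)) → ℝ) := fun g =>
    Measurable.ite ((F.isClosed_aligned n).preimage (continuous_shift g)).measurableSet
      measurable_const measurable_const
  exact (h g).div (Finset.measurable_fun_sum _ fun u _ => h u)

theorem measurable_alignedAvg (n : ℕ) {f : (G → Fin (m + 1)) → ℝ} (hf : Measurable f) :
    Measurable (F.alignedAvg n f) :=
  Finset.measurable_fun_sum _ fun u _ =>
    (F.measurable_alignedWeight n u).mul (hf.comp (measurable_shift u))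

variable {μ : Measure (orbitClosure (F.array m))}

/-- Mass transport: with `y' = σ^(v⁻¹ u) y`, the weight of `u` at `y` equals the weight of `v` at
`y'`. By invariance each term of the double sum over `u, v` may be integrated in `y'`; the sum over
`u` then cancels `|U n|`, and the weights over `v` add up to `1`. -/
theorem integral_alignedAvg_avg (hμ : IsInvariantMeasure (subshiftAction (F.array m)) μ) {n : ℕ}
    (hn : 1 ≤ n) {f : (G → Fin (m + 1)) → ℝ} (hf : Measurable f) {C : ℝ} (hC : ∀ x, |f x| ≤ C) :
    ∫ y, F.alignedAvg n (F.avg n f) y.1 ∂μ = ∫ y, f y.1 ∂μ := by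
  obtain ⟨_, hφ⟩ := isInvariantMeasure_iff.1 hμ
  have hU := F.card_U_pos n
  set k : G → orbitClosure (F.array m) → ℝ := fun v y =>
    F.alignedWeight n v y.1 * f y.1 / (F.U n).card with hk
  have hkm : ∀ v, Measurable (k v) := fun v =>
    (((F.measurable_alignedWeight n v).mul hf).comp measurable_subtype_coe).div_const _
  have hw1 : ∀ u ∈ F.U n, ∀ y : orbitClosure (F.array m), F.alignedWeight n u y.1 ≤ 1 := by
    intro u hu y
    rw [← F.sum_alignedWeight hn y.2]
    exact Finset.single_le_sum (fun v _ => F.alignedWeight_nonneg n v y.1) hu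
  have hki : ∀ v ∈ F.U n, Integrable (k v) μ := fun v hv => by
    refine integrable_of_abs_le (hkm v) (C := C / (F.U n).card) fun y => ?_
    rw [hk, abs_div, abs_of_pos hU, abs_mul, abs_of_nonneg (F.alignedWeight_nonneg n v _)]
    gcongr
    calc _ ≤ 1 * |f y.1| := by gcongr; exact hw1 v hv y
      _ ≤ C := by rw [one_mul]; exact hC _
  have hint : ∀ u v, ∫ y, k v (subshiftAction (F.array m) (v⁻¹ * u) y) ∂μ = ∫ y, k v y ∂μ := by
    intro u v
    conv_rhs => rw [← (hφ (v⁻¹ * u)).map_eq]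
    rw [integral_map (measurable_subshiftAction _).aemeasurable (hkm v).aestronglyMeasurable]
  have h1 : ∀ y : orbitClosure (F.array m), F.alignedAvg n (F.avg n f) y.1 =
      ∑ u ∈ F.U n, ∑ v ∈ F.U n, k v (subshiftAction (F.array m) (v⁻¹ * u) y) := by
    intro y
    rw [alignedAvg]
    refine Finset.sum_congr rfl fun u _ => ?_
    rw [avg, Finset.sum_div, Finset.mul_sum]
    refine Finset.sum_congr rfl fun v _ => ?_
    simp only [hk, subshiftAction, alignedWeight_shift, shift_shift, mul_inv_cancel_left,
      mul_div_assoc]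
  simp_rw [h1]
  have hki' : ∀ u, ∀ v ∈ F.U n,
      Integrable (fun y => k v (subshiftAction (F.array m) (v⁻¹ * u) y)) μ := fun u v hv =>
    (hφ (v⁻¹ * u)).integrable_comp_of_integrable (hki v hv)
  rw [integral_finsetSum _ fun u _ => integrable_finsetSum _ fun v hv => hki' u v hv]
  rw [Finset.sum_congr rfl fun u _ => integral_finsetSum _ fun v hv => hki' u v hv]
  simp_rw [hint]
  rw [Finset.sum_const, nsmul_eq_mul, ← integral_finsetSum _ hki, ← integral_const_mul]
  refine integral_congr_ae (ae_of_all _ fun y => ?_)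
  simp only [hk]
  rw [← Finset.sum_div, ← Finset.sum_mul, F.sum_alignedWeight hn y.2]
  field_simp

/-- Integrals against an invariant measure are, up to the variation of the averages over
configurations with equal blocks, convex combinations of averages along the blocks. -/
theorem exists_approx (hμ : IsInvariantMeasure (subshiftAction (F.array m)) μ) {n : ℕ}
    (hn : 1 ≤ n) (x : Fin m → G → Fin (m + 1)) :
    ∃ c : Fin m → ℝ, (∀ a, 0 ≤ c a) ∧ ∑ a, c a = 1 ∧
      ∀ f : (G → Fin (m + 1)) → ℝ, Measurable f → ∀ C, (∀ x, |f x| ≤ C) → ∀ K,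
        (∀ a z, F.HasType n a z → |F.avg n f z - F.avg n f (x a)| ≤ K) →
        |∫ y, f y.1 ∂μ - ∑ a, c a * F.avg n f (x a)| ≤ K := by
  have := hμ.1
  -- At a gap `emb d` of `U n`, the block of type `a` shows the symbol `a` itself, so one coordinate
  -- detects the type.
  obtain ⟨d, hd, hl⟩ := F.exists_level_eq n
  have hdU : F.emb d ∈ F.U n := by
    rw [mem_U, ← mul_one (F.emb d), F.coord_emb_mul _ _ F.one_mem]; exact hd
  have hblock : ∀ a : Fin m, F.block n a (F.emb d) = a.castSucc := by
    intro a
    rw [block, if_neg]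
    rw [← mul_one (F.emb d), F.coord_emb_mul _ _ F.one_mem]; omega
  set χ : Fin m → (G → Fin (m + 1)) → ℝ := fun a z =>
    if z (F.emb d) = a.castSucc then 1 else 0 with hχ
  have hχt : ∀ a b z, F.HasType n b z → χ a z = if a = b then 1 else 0 := by
    intro a b z hz
    simp only [hχ, hz _ hdU, hblock, Fin.castSucc_inj, eq_comm]
  have hχm : ∀ a, Measurable (χ a) := fun a =>
    Measurable.ite (measurable_pi_apply (F.emb d) (measurableSet_singleton _))
      measurable_const measurable_const
  have hχ0 : ∀ a z, 0 ≤ χ a z := fun a z => by simp only [hχ]; split_ifs <;> norm_num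
  have hχ1 : ∀ a z, |χ a z| ≤ 1 := fun a z => by simp only [hχ]; split_ifs <;> norm_num
  have hint : ∀ {g : (G → Fin (m + 1)) → ℝ}, Measurable g → ∀ {C}, (∀ z, |g z| ≤ C) →
      Integrable (fun y : orbitClosure (F.array m) => F.alignedAvg n g y.1) μ :=
    fun {g} hg {C} hC => integrable_of_abs_le ((F.measurable_alignedAvg n hg).comp
      measurable_subtype_coe) fun y => F.abs_alignedAvg_le hn (fun z _ => hC z) y.2
  have hsum : ∀ e : Fin m → ℝ, ∑ a, (∫ y, F.alignedAvg n (χ a) y.1 ∂μ) * e a =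
      ∫ y, F.alignedAvg n (fun z => ∑ a, χ a z * e a) y.1 ∂μ := by
    intro e
    simp_rw [← integral_mul_const]
    rw [← integral_finsetSum _ fun a _ => (hint (hχm a) (hχ1 a)).mul_const _]
    refine integral_congr_ae (ae_of_all _ fun y => ?_)
    simp only [alignedAvg, Finset.sum_mul, Finset.mul_sum]
    rw [Finset.sum_comm]
    simp only [mul_assoc]
  have hsel : ∀ (e : Fin m → ℝ) b z, F.HasType n b z → ∑ a, χ a z * e a = e b := by
    intro e b z hz
    simp [hχt _ b z hz]
  -- The coefficient of `a` is the probability that a random alignment of a `μ`-random point shows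
  -- the type `a`.
  refine ⟨fun a => ∫ y, F.alignedAvg n (χ a) y.1 ∂μ, fun a => ?_, ?_, ?_⟩
  · exact integral_nonneg fun y => Finset.sum_nonneg fun u _ =>
      mul_nonneg (F.alignedWeight_nonneg n u _) (hχ0 a _)
  · have h1 := hsum fun _ => 1
    simp only [mul_one] at h1
    rw [h1]
    have : ∀ y : orbitClosure (F.array m), F.alignedAvg n (fun z => ∑ a, χ a z) y.1 = 1 := by
      intro y
      rw [← F.sum_alignedWeight hn y.2, alignedAvg]
      refine Finset.sum_congr rfl fun u _ => ?_
      by_cases h : F.alignedWeight n u y.1 = 0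
      · simp [h]
      · obtain ⟨b, hb⟩ := (F.aligned_of_alignedWeight_ne_zero h).exists_hasType
        have := hsel (fun _ => 1) b _ hb
        simp only [mul_one] at this
        rw [this, mul_one]
    simp [this]
  · intro f hf C hC K hK
    set g : (G → Fin (m + 1)) → ℝ := fun z => ∑ a, χ a z * F.avg n f (x a) with hg
    have hgm : Measurable g := Finset.measurable_fun_sum _ fun a _ => (hχm a).mul_const _
    have hgb : ∀ z, |g z| ≤ ∑ a, |F.avg n f (x a)| := by
      intro z
      refine (Finset.abs_sum_le_sum_abs _ _).trans (Finset.sum_le_sum fun a _ => ?_)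
      rw [abs_mul]
      exact mul_le_of_le_one_left (abs_nonneg _) (hχ1 a z)
    rw [hsum, ← F.integral_alignedAvg_avg hμ hn hf hC,
      ← integral_sub (hint (F.measurable_avg n hf) (F.abs_avg_le n hC)) (hint hgm hgb)]
    have hbound : ∀ y : orbitClosure (F.array m),
        ‖F.alignedAvg n (F.avg n f) y.1 - F.alignedAvg n g y.1‖ ≤ K := by
      intro y
      have : F.alignedAvg n (F.avg n f) y.1 - F.alignedAvg n g y.1 =
          F.alignedAvg n (fun z => F.avg n f z - g z) y.1 := by
        simp only [alignedAvg, mul_sub, Finset.sum_sub_distrib]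
      rw [this, Real.norm_eq_abs]
      refine F.abs_alignedAvg_le hn (fun z hz => ?_) y.2
      obtain ⟨b, hb⟩ := hz.exists_hasType
      rw [show g z = _ from hsel _ b z hb]
      exact hK b z hb
    have hle := norm_integral_le_of_norm_le_const (μ := μ) (ae_of_all _ hbound)
    rwa [probReal_univ, mul_one] at hle

end TiledGroup

end VirtToeplitz

namespace VirtToeplitz

/-! ### Symbol frequencies of invariant measures, and existence of the extreme ones. -/

/-- A continuous function on a full shift depends, up to `ε`, on finitely many coordinates. -/
theorem exists_finset_abs_sub_le {G A : Type*} [TopologicalSpace A] [DiscreteTopology A] [Finite A]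
    (f : C(G → A, ℝ)) {ε : ℝ} (hε : 0 < ε) :
    ∃ W : Finset G, ∀ x y : G → A, (∀ w ∈ W, x w = y w) → |f x - f y| ≤ ε := by
  have hK : IsCompact {p : (G → A) × (G → A) | ε ≤ |f p.1 - f p.2|} := by
    refine IsClosed.isCompact (isClosed_le continuous_const ?_)
    fun_prop
  have hO : ∀ w : G, IsOpen {p : (G → A) × (G → A) | p.1 w ≠ p.2 w} := fun w => by
    have : Continuous fun p : (G → A) × (G → A) => (p.1 w, p.2 w) := by fun_prop
    exact (isOpen_discrete {q : A × A | q.1 ≠ q.2}).preimage this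
  obtain ⟨W, hW⟩ := hK.elim_finite_subcover _ hO fun p hp => by
    have hne : p.1 ≠ p.2 := by
      intro h
      have hp' : ε ≤ |f p.1 - f p.2| := hp
      rw [h, sub_self, abs_zero] at hp'
      exact absurd hε (not_lt.2 hp')
    obtain ⟨w, hw⟩ := Function.ne_iff.1 hne
    exact mem_iUnion.2 ⟨w, hw⟩
  refine ⟨W, fun x y h => ?_⟩
  by_contra! hlt
  obtain ⟨w, hw, hne⟩ := mem_iUnion₂.1 (hW (show (x, y) ∈ _ from hlt.le))
  exact hne (h w hw)

/-- The inclusion of the closed orbit closure is a measurable embedding, so test functions on the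
full shift suffice. -/
theorem measure_ext_of_integral_eq {G A : Type*} [Group G] [Countable G] [TopologicalSpace A]
    [DiscreteTopology A] [Finite A] [MeasurableSpace A] [BorelSpace A] {x : G → A}
    {μ ν : Measure (orbitClosure x)} [IsFiniteMeasure μ] [IsFiniteMeasure ν]
    (h : ∀ f : C(G → A, ℝ), ∫ y, f y.1 ∂μ = ∫ y, f y.1 ∂ν) : μ = ν := by
  have hm : MeasurableEmbedding (Subtype.val : orbitClosure x → G → A) :=
    MeasurableEmbedding.subtype_coe isClosed_closure.measurableSet
  have : μ.map Subtype.val = ν.map Subtype.val := by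
    refine ext_of_forall_integral_eq_of_IsFiniteMeasure fun f => ?_
    rw [hm.integral_map, hm.integral_map]
    exact h f.toContinuousMap
  rw [← hm.comap_map μ, this, hm.comap_map]

namespace TiledGroup

open Classical

variable {G V : Type*} [Group G] [AddCommGroup V] (F : TiledGroup G V) {m : ℕ} [NeZero m]

/-- The vector of the measures of the symbols at the identity. -/
noncomputable def symbols (μ : Measure (orbitClosure (F.array m))) (b : Fin (m + 1)) : ℝ :=
  μ.real {x | x.1 1 = b}

/-- The indicator function of the cylinder of a symbol at the identity. -/
noncomputable def symbolInd (b : Fin (m + 1)) : C(G → Fin (m + 1), ℝ) where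
  toFun x := if x 1 = b then 1 else 0
  continuous_toFun := (continuous_of_discreteTopology (f := fun c : Fin (m + 1) =>
    if c = b then (1 : ℝ) else 0)).comp (continuous_apply 1)

theorem integral_symbolInd (μ : Measure (orbitClosure (F.array m))) (b : Fin (m + 1)) :
    ∫ y, symbolInd b y.1 ∂μ = F.symbols μ b := by
  have hev : Measurable fun x : orbitClosure (F.array m) => x.1 1 :=
    (measurable_pi_apply (1 : G)).comp measurable_subtype_coe
  have hS : MeasurableSet {x : orbitClosure (F.array m) | x.1 1 = b} :=
    hev (measurableSet_singleton b)
  rw [symbols, ← integral_indicator_one hS]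
  exact integral_congr_ae (ae_of_all _ fun y => by simp [symbolInd, indicator])

theorem avg_symbolInd {n : ℕ} {a : Fin m} {z : G → Fin (m + 1)} (h : F.HasType n a z)
    (b : Fin (m + 1)) :
    F.avg n (symbolInd b) z = F.symbolFreq m b n + if b = a.castSucc then F.gap n else 0 := by
  rw [← F.card_symbol_of_hasType h b, ← avg_symbol]
  rfl

theorem exists_mem_hasType {n : ℕ} (hn : 1 ≤ n) (a : Fin m) :
    ∃ z ∈ orbitClosure (F.array m), F.HasType n a z := by
  obtain ⟨g, hg⟩ := F.exists_shift_hasType hn a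
  exact ⟨_, subset_closure ⟨g, rfl⟩, hg⟩

variable [Countable G] {μ : Measure (orbitClosure (F.array m))}

/-- One family of coefficients serves all test functions. Averages of symbol indicators depend on
the block type only, which turns their estimates into equalities. -/
theorem exists_coeff (hμ : IsInvariantMeasure (subshiftAction (F.array m)) μ) {n : ℕ}
    (hn : 1 ≤ n) {x : Fin m → G → Fin (m + 1)} (hx : ∀ a, F.HasType n a (x a)) :
    ∃ c : Fin m → ℝ, (∀ a, 0 ≤ c a) ∧ ∑ a, c a = 1 ∧
      (∀ a, F.symbols μ a.castSucc = F.symbolFreq m a.castSucc n + c a * F.gap n) ∧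
      F.symbols μ (Fin.last m) = F.symbolFreq m (Fin.last m) n ∧
      ∀ (f : C(G → Fin (m + 1), ℝ)) (ε : ℝ) (W : Finset G),
        (∀ x y, (∀ w ∈ W, x w = y w) → |f x - f y| ≤ ε) →
        |∫ y, f y.1 ∂μ - ∑ a, c a * F.avg n f (x a)| ≤ ε + 2 * ‖f‖ * F.boundary W n := by
  obtain ⟨c, hc0, hc1, hc⟩ := F.exists_approx hμ hn x
  have hsym : ∀ b, F.symbols μ b =
      F.symbolFreq m b n + ∑ a, c a * if b = a.castSucc then F.gap n else 0 := by
    intro b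
    -- The variation bound is `0` here, since the average of a one-coordinate function at the
    -- identity only reads the block on `U n`.
    have h := hc (symbolInd b) (symbolInd b).continuous.measurable ‖symbolInd (G := G) b‖
      (symbolInd b).norm_coe_le_norm 0 fun a z hz => by
        rw [F.avg_symbolInd hz, F.avg_symbolInd (hx a)]; simp
    rw [integral_symbolInd, abs_nonpos_iff, sub_eq_zero] at h
    rw [h]
    simp_rw [fun a => F.avg_symbolInd (hx a) b, mul_add, Finset.sum_add_distrib, ← Finset.sum_mul,
      hc1, one_mul]
  refine ⟨c, hc0, hc1, fun a => ?_, ?_, fun f ε W hW => ?_⟩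
  · rw [hsym]; simp [Fin.castSucc_inj]
  · rw [hsym]; simp [Fin.ext_iff, (Fin.is_lt _).ne']
  · refine hc f f.continuous.measurable ‖f‖ f.norm_coe_le_norm _ fun a z hz => ?_
    exact F.abs_avg_sub_le n f.norm_coe_le_norm hW fun u hu => by rw [hz u hu, hx a u hu]

/-- An invariant measure is determined by its values on the symbols. -/
theorem eq_of_symbols_eq {ν : Measure (orbitClosure (F.array m))}
    (hμ : IsInvariantMeasure (subshiftAction (F.array m)) μ)
    (hν : IsInvariantMeasure (subshiftAction (F.array m)) ν)
    (h : ∀ a : Fin m, F.symbols μ a.castSucc = F.symbols ν a.castSucc) : μ = ν := by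
  have := hμ.1
  have := hν.1
  refine measure_ext_of_integral_eq fun f => ?_
  rw [← sub_eq_zero, ← abs_nonpos_iff]
  refine le_of_forall_pos_le_add fun ε hε => ?_
  obtain ⟨W, hW⟩ := exists_finset_abs_sub_le f (half_pos hε)
  have hlim : Tendsto (fun n => 2 * (ε / 2 + 2 * ‖f‖ * F.boundary W n)) atTop
      (𝓝 (2 * (ε / 2 + 2 * ‖f‖ * 0))) :=
    (((F.tendsto_boundary W).const_mul _).const_add _).const_mul _
  have hle : |∫ y, f y.1 ∂μ - ∫ y, f y.1 ∂ν| ≤ 2 * (ε / 2 + 2 * ‖f‖ * 0) := by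
    refine ge_of_tendsto hlim ((eventually_ge_atTop 1).mono fun n hn => ?_)
    choose x _ hx using fun a : Fin m => F.exists_mem_hasType hn a
    obtain ⟨c, -, -, hc, -, hcf⟩ := F.exists_coeff hμ hn hx
    obtain ⟨c', -, -, hc', -, hcf'⟩ := F.exists_coeff hν hn hx
    -- The coefficients are recovered from the symbol measures by dividing by the positive `gap n`.
    have hcc : c = c' := funext fun a => by
      have := h a
      rw [hc, hc', add_right_inj] at this
      exact mul_right_cancel₀ (F.gap_pos n).ne' this
    subst hcc
    have h1 := abs_le.1 (hcf f _ W hW)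
    have h2 := abs_le.1 (hcf' f _ W hW)
    rw [abs_le]
    constructor <;> linarith
  linarith

/-! ### Limits -/

/-- The limit frequency of a symbol among the positions that are eventually filled. -/
noncomputable def limFreq (m : ℕ) [NeZero m] (b : Fin (m + 1)) : ℝ :=
  (F.exists_tendsto_symbolFreq b).choose

omit [Countable G] in
theorem limFreq_nonneg (b : Fin (m + 1)) : 0 ≤ F.limFreq m b :=
  (F.exists_tendsto_symbolFreq b).choose_spec.1

omit [Countable G] in
theorem tendsto_symbolFreq (b : Fin (m + 1)) :
    Tendsto (F.symbolFreq m b) atTop (𝓝 (F.limFreq m b)) :=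
  (F.exists_tendsto_symbolFreq b).choose_spec.2

/-- The limit proportion of the gaps. -/
noncomputable def limGap : ℝ := F.exists_tendsto_gap.choose

omit [Countable G] in
theorem limGap_pos : 0 < F.limGap := F.exists_tendsto_gap.choose_spec.1

omit [Countable G] in
theorem tendsto_gap : Tendsto F.gap atTop (𝓝 F.limGap) := F.exists_tendsto_gap.choose_spec.2

omit [Countable G] in
theorem sum_limFreq : ∑ b, F.limFreq m b = 1 - F.limGap := by
  refine tendsto_nhds_unique (tendsto_finsetSum _ fun b _ => F.tendsto_symbolFreq b) ?_
  simp_rw [sum_symbolFreq]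
  exact F.tendsto_gap.const_sub 1

/-- The vector of symbol frequencies when all gaps are filled by the symbol `a`. -/
noncomputable def extremeVec (a : Fin m) (b : Fin (m + 1)) : ℝ :=
  F.limFreq m b + if b = a.castSucc then F.limGap else 0

/-- The coefficients at stage `n` are an explicit quotient of convergent sequences, so they converge
themselves and no subsequence has to be extracted. -/
theorem exists_symbols_eq (hμ : IsInvariantMeasure (subshiftAction (F.array m)) μ) :
    ∃ c : Fin m → ℝ, (∀ a, 0 ≤ c a) ∧ ∑ a, c a = 1 ∧
      F.symbols μ = ∑ a, c a • F.extremeVec a := by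
  choose! x hxm hx using fun (n : ℕ) (hn : 1 ≤ n) (a : Fin m) => F.exists_mem_hasType hn a
  have hex := fun (n : ℕ) (hn : 1 ≤ n) => F.exists_coeff hμ hn (hx n hn)
  choose! c hc0 hc1 hc hcl _ using hex
  have hδ := F.limGap_pos
  have hlim : ∀ a : Fin m, Tendsto (fun n => c n a) atTop
      (𝓝 ((F.symbols μ a.castSucc - F.limFreq m a.castSucc) / F.limGap)) := by
    intro a
    refine (((F.tendsto_symbolFreq a.castSucc).const_sub _).div F.tendsto_gap hδ.ne').congr' ?_
    filter_upwards [eventually_ge_atTop 1] with n hn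
    rw [Pi.div_apply, hc n hn a, add_sub_cancel_left, mul_div_cancel_right₀ _ (F.gap_pos n).ne']
  have hlast : F.symbols μ (Fin.last m) = F.limFreq m (Fin.last m) := by
    refine tendsto_nhds_unique (tendsto_const_nhds.congr' ?_) (F.tendsto_symbolFreq _)
    filter_upwards [eventually_ge_atTop 1] with n hn using hcl n hn
  have hsum1 : ∑ a : Fin m, (F.symbols μ a.castSucc - F.limFreq m a.castSucc) / F.limGap = 1 := by
    refine tendsto_nhds_unique (tendsto_finsetSum _ fun a _ => hlim a)
      (tendsto_const_nhds.congr' ?_)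
    filter_upwards [eventually_ge_atTop 1] with n hn using (hc1 n hn).symm
  refine ⟨fun a => (F.symbols μ a.castSucc - F.limFreq m a.castSucc) / F.limGap, fun a => ?_,
    hsum1, ?_⟩
  · exact ge_of_tendsto (hlim a) ((eventually_ge_atTop 1).mono fun n hn => hc0 n hn a)
  · funext b
    simp only [Finset.sum_apply, Pi.smul_apply, smul_eq_mul, extremeVec, mul_add,
      Finset.sum_add_distrib, ← Finset.sum_mul, hsum1, one_mul]
    refine Fin.lastCases ?_ (fun a => ?_) b
    · rw [hlast]; simp [Fin.ext_iff, (Fin.is_lt _).ne']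
    · simp only [Fin.castSucc_inj, mul_ite, mul_zero, Finset.sum_ite_eq, Finset.mem_univ, if_true]
      field_simp
      ring

omit [Countable G] in
theorem sum_smul_extremeVec_castSucc {c : Fin m → ℝ} (hc : ∑ a, c a = 1) (b : Fin m) :
    (∑ a, c a • F.extremeVec a) b.castSucc = F.limFreq m b.castSucc + c b * F.limGap := by
  simp only [Finset.sum_apply, Pi.smul_apply, smul_eq_mul, extremeVec, mul_add,
      Finset.sum_add_distrib, ← Finset.sum_mul, hc, one_mul]
  simp [Fin.castSucc_inj]

/-- The averages along blocks of type `a` converge to the integral against the invariant measure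
with symbol vector `extremeVec a`. -/
theorem tendsto_avg (hμ : IsInvariantMeasure (subshiftAction (F.array m)) μ) {a : Fin m}
    (ha : F.symbols μ = F.extremeVec a) (f : C(G → Fin (m + 1), ℝ)) {ε : ℝ} (hε : 0 < ε) :
    ∀ᶠ n in atTop, ∀ z, F.HasType n a z → |F.avg n f z - ∫ y, f y.1 ∂μ| < ε := by
  obtain ⟨W, hW⟩ := exists_finset_abs_sub_le f (half_pos hε)
  have hδ := F.limGap_pos
  have hlim : Tendsto (fun n => (ε / 2 + 2 * ‖f‖ * F.boundary W n) + 2 * ‖f‖ *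
      (1 - (F.symbols μ a.castSucc - F.symbolFreq m a.castSucc n) / F.gap n)) atTop
      (𝓝 ((ε / 2 + 2 * ‖f‖ * 0) + 2 * ‖f‖ *
      (1 - (F.symbols μ a.castSucc - F.limFreq m a.castSucc) / F.limGap))) :=
    (((F.tendsto_boundary W).const_mul _).const_add _).add
      (((((F.tendsto_symbolFreq a.castSucc).const_sub _).div F.tendsto_gap hδ.ne').const_sub
        1).const_mul _)
  -- The symbol vector `extremeVec a` forces the coefficient of `a` to tend to `1`, so in the limit
  -- only `ε / 2` of the error remains.
  have h0 : (ε / 2 + 2 * ‖f‖ * 0) + 2 * ‖f‖ *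
      (1 - (F.symbols μ a.castSucc - F.limFreq m a.castSucc) / F.limGap) < ε := by
    rw [ha, extremeVec, if_pos rfl, add_sub_cancel_left, div_self hδ.ne']
    simp [hε]
  filter_upwards [hlim.eventually (gt_mem_nhds h0), eventually_ge_atTop 1] with n hlt hn z hz
  choose x _ hx using fun a : Fin m => F.exists_mem_hasType hn a
  -- The given `z` is used as the representative of type `a`, so the estimate is uniform over all
  -- configurations of that type.
  have hx' : ∀ b, F.HasType n b (Function.update x a z b) := by
    intro b
    by_cases h : b = a
    · subst h; simpa using hz
    · simpa [h] using hx b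
  obtain ⟨c, hc0, hc1, hc, -, hcf⟩ := F.exists_coeff hμ hn hx'
  have h1 := hcf f _ W hW
  have hca : (F.symbols μ a.castSucc - F.symbolFreq m a.castSucc n) / F.gap n = c a := by
    rw [hc a, add_sub_cancel_left, mul_div_cancel_right₀ _ (F.gap_pos n).ne']
  rw [hca] at hlt
  have h2 : |∑ b, c b * F.avg n f (Function.update x a z b) - F.avg n f z| ≤
      2 * ‖f‖ * (1 - c a) := by
    have e1 : ∑ b, c b * F.avg n f (Function.update x a z b) - F.avg n f z =
        ∑ b, c b * (F.avg n f (Function.update x a z b) - F.avg n f z) := by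
      simp only [mul_sub, Finset.sum_sub_distrib, ← Finset.sum_mul, hc1, one_mul]
    have e2 : 1 - c a = ∑ b, if b = a then 0 else c b := by
      rw [← hc1, ← Finset.add_sum_erase _ _ (Finset.mem_univ a), add_sub_cancel_left,
        ← Finset.filter_ne', Finset.sum_filter]
      simp only [ne_eq, ite_not]
    rw [e1, e2, Finset.mul_sum]
    refine (Finset.abs_sum_le_sum_abs _ _).trans (Finset.sum_le_sum fun b _ => ?_)
    split_ifs with hb
    · subst hb; simp
    · rw [abs_mul, abs_of_nonneg (hc0 b), mul_comm]
      refine mul_le_mul_of_nonneg_right ?_ (hc0 b)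
      have i1 := abs_le.1 (F.abs_avg_le n f.norm_coe_le_norm (Function.update x a z b))
      have i2 := abs_le.1 (F.abs_avg_le n f.norm_coe_le_norm z)
      rw [abs_le]; constructor <;> linarith
  have i1 := abs_le.1 h1
  have i2 := abs_le.1 h2
  rw [abs_lt]; constructor <;> linarith

/-- The uniform measure on the translates of `z` indexed by `U n`. -/
noncomputable def empirical (n : ℕ) (z : orbitClosure (F.array m)) :
    Measure (orbitClosure (F.array m)) :=
  ((F.U n).card : ENNReal)⁻¹ •
    ∑ u ∈ F.U n, Measure.dirac (subshiftAction (F.array m) u⁻¹ z)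

omit [Countable G] in
theorem isProbabilityMeasure_empirical (n : ℕ) (z : orbitClosure (F.array m)) :
    IsProbabilityMeasure (F.empirical n z) := by
  refine ⟨?_⟩
  have : (F.U n).card ≠ 0 := (Finset.card_pos.2 ⟨1, F.one_mem_U n⟩).ne'
  simp only [empirical, Measure.smul_apply, Measure.finsetSum_apply, measure_univ,
    Finset.sum_const, nsmul_eq_mul, mul_one, smul_eq_mul]
  exact ENNReal.inv_mul_cancel (by exact_mod_cast this) (by simp)

theorem integral_empirical (n : ℕ) (z : orbitClosure (F.array m)) (f : C(G → Fin (m + 1), ℝ)) :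
    ∫ y, f y.1 ∂(F.empirical n z) = F.avg n f z.1 := by
  have hf : Measurable fun y : orbitClosure (F.array m) => f y.1 :=
    f.continuous.measurable.comp measurable_subtype_coe
  rw [empirical, integral_smul_measure, integral_finsetSum_measure
    fun u _ => integrable_of_abs_le hf fun y => f.norm_coe_le_norm _]
  simp_rw [integral_dirac' _ _ hf.stronglyMeasurable]
  rw [avg, div_eq_inv_mul]
  simp [subshiftAction]

/-- There is an invariant measure with symbol vector `extremeVec a`. -/
theorem exists_invariant (a : Fin m) : ∃ ν : Measure (orbitClosure (F.array m)),
    IsInvariantMeasure (subshiftAction (F.array m)) ν ∧ F.symbols ν = F.extremeVec a := by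
  have : CompactSpace (orbitClosure (F.array m)) :=
    isCompact_iff_compactSpace.1 isClosed_closure.isCompact
  have hz : ∀ n, ∃ z : orbitClosure (F.array m), 1 ≤ n → F.HasType n a z.1 := by
    intro n
    by_cases hn : 1 ≤ n
    · obtain ⟨z, hz, h⟩ := F.exists_mem_hasType hn a
      exact ⟨⟨z, hz⟩, fun _ => h⟩
    · exact ⟨⟨_, subset_closure ⟨1, rfl⟩⟩, fun h => absurd h hn⟩
  choose z hz using hz
  set P : ℕ → ProbabilityMeasure (orbitClosure (F.array m)) := fun n =>
    ⟨F.empirical n (z n), F.isProbabilityMeasure_empirical n _⟩ with hP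
  -- A limit along a nonprincipal ultrafilter exists by compactness, and it agrees with every limit
  -- along `atTop` that exists.
  obtain ⟨ν, -, hν⟩ := isCompact_univ.ultrafilter_le_nhds ((hyperfilter ℕ).map P) (by simp)
  have hle : (hyperfilter ℕ : Filter ℕ) ≤ atTop := Nat.hyperfilter_le_atTop
  have hconv : ∀ f : C(G → Fin (m + 1), ℝ),
      Tendsto (fun n => F.avg n f (z n).1) (hyperfilter ℕ)
        (𝓝 (∫ y, f y.1 ∂(ν : Measure (orbitClosure (F.array m))))) := by
    intro f
    have ht : Tendsto P (hyperfilter ℕ) (𝓝 ν) := hν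
    have := ProbabilityMeasure.tendsto_iff_forall_integral_tendsto.1 ht
      (BoundedContinuousFunction.mkOfCompact (f.comp ⟨Subtype.val, continuous_subtype_val⟩))
    refine this.congr fun n => ?_
    exact F.integral_empirical n (z n) f
  refine ⟨ν, isInvariantMeasure_iff.2 ⟨inferInstance, fun g => ⟨measurable_subshiftAction g, ?_⟩⟩,
    ?_⟩
  · have : IsProbabilityMeasure ((ν : Measure (orbitClosure (F.array m))).map (subshiftAction (F.array m) g)) :=
      Measure.isProbabilityMeasure_map (measurable_subshiftAction g).aemeasurable
    refine measure_ext_of_integral_eq fun f => ?_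
    have hf : Measurable fun y : orbitClosure (F.array m) => f y.1 :=
      f.continuous.measurable.comp measurable_subtype_coe
    rw [integral_map (measurable_subshiftAction g).aemeasurable hf.aestronglyMeasurable]
    have h1 := hconv (f.comp ⟨shift g, continuous_shift g⟩)
    have h2 := hconv f
    have h3 : Tendsto (fun n => F.avg n (f.comp ⟨shift g, continuous_shift g⟩) (z n).1 -
        F.avg n f (z n).1) (hyperfilter ℕ) (𝓝 0) := by
      refine squeeze_zero_norm (fun n => F.abs_avg_shift_sub_le n f.norm_coe_le_norm g (z n).1) ?_
      simpa using ((F.tendsto_boundary {g⁻¹}).const_mul (2 * ‖f‖)).mono_left hle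
    exact sub_eq_zero.1 (tendsto_nhds_unique (h1.sub h2) h3)
  · funext b
    rw [← integral_symbolInd]
    refine tendsto_nhds_unique (hconv (symbolInd b)) ?_
    have h1 : Tendsto (fun n => F.symbolFreq m b n + if b = a.castSucc then F.gap n else 0) atTop
        (𝓝 (F.extremeVec a b)) := by
      refine (F.tendsto_symbolFreq b).add ?_
      split_ifs
      exacts [F.tendsto_gap, tendsto_const_nhds]
    refine (h1.congr' ?_).mono_left hle
    filter_upwards [eventually_ge_atTop 1] with n hn
    rw [F.avg_symbolInd (hz n hn)]

end TiledGroup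

end VirtToeplitz

namespace VirtToeplitz

/-! ### Ergodic measures and the simplex of invariant measures. -/

section Ergodic

variable {G A : Type*} [Group G] [TopologicalSpace A] [MeasurableSpace A] {x : G → A}
  {μ ν : Measure (orbitClosure x)}

theorem IsInvariantMeasure.cond (hμ : IsInvariantMeasure (subshiftAction x) μ)
    {S : Set (orbitClosure x)} (hS : MeasurableSet S) (hinv : ∀ g, subshiftAction x g '' S = S)
    (h0 : μ S ≠ 0) : IsInvariantMeasure (subshiftAction x) (ProbabilityTheory.cond μ S) := by
  obtain ⟨_, hφ⟩ := isInvariantMeasure_iff.1 hμ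
  refine isInvariantMeasure_iff.2 ⟨ProbabilityTheory.cond_isProbabilityMeasure h0, fun g => ?_⟩
  have h := (hφ g).restrict_preimage hS
  have hp : subshiftAction x g ⁻¹' S = S := by
    rw [← hinv g⁻¹, image_subshiftAction, inv_inv, ← preimage_comp]
    have : subshiftAction x g ∘ subshiftAction x g = subshiftAction x (g * g) :=
      funext fun y => subshiftAction_mul g g y
    rw [this, ← inv_inv (g * g), ← image_subshiftAction, hinv, ← inv_inv g,
      ← image_subshiftAction, hinv]
  rw [hp] at h
  exact h.smul_measure _

/-- An ergodic measure is minimal, for absolute continuity, among the invariant measures. -/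
theorem IsErgodicMeasure.eq_of_absolutelyContinuous [Countable G]
    (hμ : IsErgodicMeasure (subshiftAction x) μ) (hν : IsInvariantMeasure (subshiftAction x) ν)
    (hac : ν ≪ μ) : ν = μ := by
  obtain ⟨_, hφ⟩ := isInvariantMeasure_iff.1 hμ.1
  obtain ⟨_, hψ⟩ := isInvariantMeasure_iff.1 hν
  set f := ν.rnDeriv μ with hf
  have hfm : Measurable f := Measure.measurable_rnDeriv ν μ
  have hinv : ∀ g, f ∘ subshiftAction x g =ᵐ[μ] f := fun g => (hψ g).rnDeriv_comp_aeEq (hφ g)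
  have hint : ∫⁻ y, f y ∂μ = 1 := by rw [hf, Measure.lintegral_rnDeriv hac, measure_univ]
  -- The sublevel set of the density is only invariant almost everywhere; quantifying over the whole
  -- orbit gives a strictly invariant set, equal to it almost everywhere because `G` is countable.
  set T : Set (orbitClosure x) := {y | ∀ g, f (subshiftAction x g y) < 1} with hT
  have hTm : MeasurableSet T := by
    have : T = ⋂ g, {y | f (subshiftAction x g y) < 1} := by ext; simp [hT]
    rw [this]
    exact MeasurableSet.iInter fun g =>
      (hfm.comp (measurable_subshiftAction g)) measurableSet_Iio
  have hTi : ∀ g, subshiftAction x g '' T = T := by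
    intro g
    rw [image_subshiftAction]
    ext y
    simp only [hT, mem_preimage, mem_ofPred_eq, subshiftAction_mul]
    refine ⟨fun h k => ?_, fun h k => h _⟩
    simpa using h (k * g)
  have hae : ∀ᵐ y ∂μ, y ∈ T ↔ f y < 1 := by
    filter_upwards [ae_all_iff.2 hinv] with y hy
    refine ⟨fun h => ?_, fun h g => ?_⟩
    · simpa [subshiftAction_one] using h 1
    · have : f (subshiftAction x g y) = f y := hy g
      rwa [this]
  have hf1 : f =ᵐ[μ] fun _ => 1 := by
    rcases hμ.2 T hTm hTi with h | h
    · have hle : (fun _ => 1) ≤ᵐ[μ] f := by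
        filter_upwards [hae, measure_eq_zero_iff_ae_notMem.1 h] with y h1 h2
        exact not_lt.1 fun h3 => h2 (h1.2 h3)
      exact (ae_eq_of_ae_le_of_lintegral_le hle (by simp) hfm.aemeasurable
        (by simp [hint])).symm
    · have hmem : ∀ᵐ y ∂μ, y ∈ T := (mem_ae_iff_prob_eq_one (μ := μ) hTm).2 h
      have hle : f ≤ᵐ[μ] fun _ => 1 := by
        filter_upwards [hae, hmem] with y h1 h2
        exact (h1.1 h2).le
      exact ae_eq_of_ae_le_of_lintegral_le hle (by simp [hint]) aemeasurable_const
        (by simp [hint])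
  rw [← Measure.withDensity_rnDeriv_eq ν μ hac, withDensity_congr_ae hf1]
  exact withDensity_one

theorem IsInvariantMeasure.sum_smul {ι : Type*} [Fintype ι] {ν : ι → Measure (orbitClosure x)}
    (hν : ∀ i, IsInvariantMeasure (subshiftAction x) (ν i)) {c : ι → NNReal}
    (hc : ∑ i, c i = 1) : IsInvariantMeasure (subshiftAction x) (∑ i, c i • ν i) := by
  have := fun i => (hν i).1
  refine ⟨⟨?_⟩, fun g S hS => ?_⟩
  · simp only [Measure.finsetSum_apply, Measure.smul_apply, measure_univ]
    simp only [ENNReal.smul_def, smul_eq_mul, mul_one]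
    rw [← ENNReal.ofNNReal_finsetSum, hc, ENNReal.coe_one]
  · simp only [Measure.finsetSum_apply, Measure.smul_apply, (hν _).2 g S hS]

end Ergodic

namespace TiledGroup

open Classical

variable {G V : Type*} [Group G] [AddCommGroup V] (F : TiledGroup G V) {m : ℕ} [NeZero m]

/-- Adding the first `m` coordinates of a relation multiplies the sum of its coefficients by a
positive number. That sum vanishes, and each coordinate then reads `c b * limGap = 0`. -/
theorem linearIndependent_extremeVec :
    LinearIndependent ℝ (F.extremeVec : Fin m → Fin (m + 1) → ℝ) := by
  have hδ := F.limGap_pos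
  rw [Fintype.linearIndependent_iff]
  intro c hc
  have h : ∀ b : Fin m, (∑ a, c a) * F.limFreq m b.castSucc + c b * F.limGap = 0 := by
    intro b
    have := congrFun hc b.castSucc
    simp only [Finset.sum_apply, Pi.smul_apply, smul_eq_mul, extremeVec, mul_add,
      Finset.sum_add_distrib, ← Finset.sum_mul] at this
    simpa [Fin.castSucc_inj] using this
  have hs : (∑ a, c a) * (∑ b : Fin m, F.limFreq m b.castSucc + F.limGap) = 0 := by
    rw [mul_add, Finset.mul_sum, Finset.sum_mul, ← Finset.sum_add_distrib]
    exact Finset.sum_eq_zero fun b _ => h b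
  have hpos : 0 < ∑ b : Fin m, F.limFreq m b.castSucc + F.limGap :=
    add_pos_of_nonneg_of_pos (Finset.sum_nonneg fun b _ => F.limFreq_nonneg _) hδ
  have h0 : ∑ a, c a = 0 := (mul_eq_zero.1 hs).resolve_right hpos.ne'
  intro b
  have := h b
  rw [h0, zero_mul, zero_add] at this
  exact (mul_eq_zero.1 this).resolve_right hδ.ne'

variable [Countable G]

omit [Countable G] in
theorem symbols_sum_smul {ν : Fin m → Measure (orbitClosure (F.array m))}
    [∀ i, IsFiniteMeasure (ν i)] (c : Fin m → NNReal) :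
    F.symbols (∑ i, c i • ν i) = ∑ i, c i • F.symbols (ν i) := by
  funext b
  rw [symbols, measureReal_def, Measure.finsetSum_apply, ENNReal.toReal_sum]
  · simp only [Finset.sum_apply, Pi.smul_apply, symbols, measureReal_def, Measure.smul_apply,
      NNReal.smul_def, ENNReal.smul_def, smul_eq_mul, ENNReal.toReal_mul, ENNReal.coe_toReal]
  · intro i _
    rw [Measure.smul_apply]
    exact ENNReal.mul_ne_top ENNReal.coe_ne_top (measure_ne_top _ _)

/-- The invariant measure with symbol vector `extremeVec a`. -/
noncomputable def extreme (a : Fin m) : Measure (orbitClosure (F.array m)) :=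
  (F.exists_invariant a).choose

theorem extreme_invariant (a : Fin m) :
    IsInvariantMeasure (subshiftAction (F.array m)) (F.extreme a) :=
  (F.exists_invariant a).choose_spec.1

theorem symbols_extreme (a : Fin m) : F.symbols (F.extreme a) = F.extremeVec a :=
  (F.exists_invariant a).choose_spec.2

theorem extreme_injective : Function.Injective (F.extreme : Fin m → _) := by
  intro a b h
  apply F.linearIndependent_extremeVec.injective
  rw [← symbols_extreme, h, symbols_extreme]

theorem mem_convexHull_range {ι E : Type*} [Fintype ι] [AddCommGroup E] [Module ℝ E]
    {v : ι → E} {x : E} :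
    x ∈ convexHull ℝ (range v) ↔
      ∃ c : ι → ℝ, (∀ i, 0 ≤ c i) ∧ ∑ i, c i = 1 ∧ ∑ i, c i • v i = x := by
  constructor
  · intro hx
    refine convexHull_min (t := {x | ∃ c : ι → ℝ, (∀ i, 0 ≤ c i) ∧ ∑ i, c i = 1 ∧
      ∑ i, c i • v i = x}) ?_ ?_ hx
    · rintro _ ⟨i, rfl⟩
      exact ⟨Pi.single i 1, fun j => by
        by_cases h : j = i <;> simp [h], by simp,
        by simp [Pi.single_apply, ite_smul]⟩
    · rintro _ ⟨c, hc0, hc1, rfl⟩ _ ⟨c', hc0', hc1', rfl⟩ a b ha hb hab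
      refine ⟨a • c + b • c', fun i => ?_, ?_, ?_⟩
      · exact add_nonneg (mul_nonneg ha (hc0 i)) (mul_nonneg hb (hc0' i))
      · simp [Finset.sum_add_distrib, ← Finset.mul_sum, hc1, hc1', hab]
      · simp [add_smul, mul_smul, Finset.sum_add_distrib, Finset.smul_sum]
  · rintro ⟨c, hc0, hc1, rfl⟩
    exact (convex_convexHull ℝ _).sum_mem (fun a _ => hc0 a) hc1
      fun a _ => subset_convexHull ℝ _ ⟨a, rfl⟩

theorem bijOn_symbols : BijOn F.symbols {μ | IsInvariantMeasure (subshiftAction (F.array m)) μ}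
    (convexHull ℝ (range (F.extremeVec : Fin m → _))) := by
  refine ⟨fun μ hμ => ?_, fun μ hμ ν hν h => F.eq_of_symbols_eq hμ hν fun a => by rw [h], ?_⟩
  · obtain ⟨c, hc0, hc1, h⟩ := F.exists_symbols_eq hμ
    exact mem_convexHull_range.2 ⟨c, hc0, hc1, h.symm⟩
  · intro v hv
    rw [mem_convexHull_range] at hv
    obtain ⟨c, hc0, hc1, rfl⟩ := hv
    have := fun a => (F.extreme_invariant (m := m) a).1
    lift c to Fin m → NNReal using hc0
    refine ⟨_, IsInvariantMeasure.sum_smul F.extreme_invariant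
      (NNReal.coe_injective (by push_cast; exact hc1)), ?_⟩
    rw [symbols_sum_smul]
    simp [symbols_extreme, NNReal.smul_def]

theorem exists_eq_sum_smul_extreme {μ : Measure (orbitClosure (F.array m))}
    (hμ : IsInvariantMeasure (subshiftAction (F.array m)) μ) :
    ∃ c : Fin m → NNReal, ∑ a, c a = 1 ∧ μ = ∑ a, c a • F.extreme a := by
  obtain ⟨c, hc0, hc1, h⟩ := F.exists_symbols_eq hμ
  have := fun a => (F.extreme_invariant (m := m) a).1
  lift c to Fin m → NNReal using hc0
  have hc1' : ∑ a, c a = 1 := NNReal.coe_injective (by push_cast; exact hc1)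
  refine ⟨c, hc1', F.bijOn_symbols.injOn hμ
    (IsInvariantMeasure.sum_smul F.extreme_invariant hc1') ?_⟩
  rw [h, symbols_sum_smul]
  simp [symbols_extreme, NNReal.smul_def]

/-- An invariant `S` of measure strictly between `0` and `1` splits the measure into its
conditionings on `S` and `Sᶜ`. Comparing coefficients at a vertex, the conditioning on `S` has the
same symbol vector, hence is the measure itself, which gives `S` measure `1`. -/
theorem isErgodicMeasure_extreme (a : Fin m) :
    IsErgodicMeasure (subshiftAction (F.array m)) (F.extreme a) := by
  have hν := F.extreme_invariant a
  have := hν.1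
  refine ⟨hν, fun S hS hinv => ?_⟩
  by_contra! h
  obtain ⟨h0, h1⟩ := h
  have h0' : F.extreme a Sᶜ ≠ 0 := by
    rwa [Ne, prob_compl_eq_zero_iff hS]
  have hinv' : ∀ g, subshiftAction (F.array m) g '' Sᶜ = Sᶜ := fun g => by
    rw [image_subshiftAction, preimage_compl, ← image_subshiftAction, hinv]
  have hc := hν.cond hS hinv h0
  have hc' := hν.cond hS.compl hinv' h0'
  obtain ⟨c, hc0, hc1, hs⟩ := F.exists_symbols_eq hc
  obtain ⟨c', hc0', hc1', hs'⟩ := F.exists_symbols_eq hc'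
  have hpos : 0 < (F.extreme a).real S := ENNReal.toReal_pos h0 (measure_ne_top _ _)
  have hpos' : 0 < (F.extreme a).real Sᶜ := ENNReal.toReal_pos h0' (measure_ne_top _ _)
  have htot : (F.extreme a).real S + (F.extreme a).real Sᶜ = 1 := probReal_add_probReal_compl hS
  have hsplit : ∀ b, F.symbols (F.extreme a) b =
      (F.extreme a).real S * F.symbols (ProbabilityTheory.cond (F.extreme a) S) b +
      (F.extreme a).real Sᶜ * F.symbols (ProbabilityTheory.cond (F.extreme a) Sᶜ) b := by
    intro b
    have hcond : ∀ B : Set (orbitClosure (F.array m)), MeasurableSet B → ∀ A,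
        (ProbabilityTheory.cond (F.extreme a) B).real A =
          ((F.extreme a).real B)⁻¹ * (F.extreme a).real (B ∩ A) := fun B hB A => by
      rw [measureReal_def, ProbabilityTheory.cond_apply hB, ENNReal.toReal_mul, ENNReal.toReal_inv]
      rfl
    rw [symbols, symbols, symbols, hcond S hS, hcond Sᶜ hS.compl, mul_inv_cancel_left₀ hpos.ne',
      mul_inv_cancel_left₀ hpos'.ne', inter_comm S, inter_comm Sᶜ, ← sdiff_eq]
    exact (measureReal_inter_add_sdiff hS).symm
  have hδ := F.limGap_pos
  have hcoef : ∀ b, (if b = a then 1 else 0) =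
      (F.extreme a).real S * c b + (F.extreme a).real Sᶜ * c' b := by
    intro b
    have := hsplit b.castSucc
    rw [hs, hs', F.sum_smul_extremeVec_castSucc hc1, F.sum_smul_extremeVec_castSucc hc1',
      symbols_extreme, extremeVec] at this
    simp only [Fin.castSucc_inj] at this
    refine mul_right_cancel₀ hδ.ne' ?_
    split_ifs at this ⊢ <;> linear_combination this + F.limFreq m b.castSucc * htot
  have hzero : ∀ b, b ≠ a → c b = 0 := by
    intro b hb
    have := hcoef b
    rw [if_neg hb] at this
    have h1 := mul_nonneg hpos.le (hc0 b)
    have h2 := mul_nonneg hpos'.le (hc0' b)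
    exact (mul_eq_zero.1 (by linarith : (F.extreme a).real S * c b = 0)).resolve_left hpos.ne'
  have hca : c a = 1 := by
    rw [← hc1]; exact (Finset.sum_eq_single a (fun b _ hb => hzero b hb) (by simp)).symm
  have heq : ProbabilityTheory.cond (F.extreme a) S = F.extreme a := by
    refine F.bijOn_symbols.injOn hc hν ?_
    rw [hs, symbols_extreme, Finset.sum_eq_single a (fun b _ hb => by rw [hzero b hb, zero_smul])
      (by simp), hca, one_smul]
  apply h1
  rw [← heq, ProbabilityTheory.cond_apply hS, inter_self, ENNReal.inv_mul_cancel h0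
    (measure_ne_top _ _)]

/-- An ergodic measure is a combination of the extreme ones; any of these with nonzero coefficient
is absolutely continuous with respect to it, hence equal to it. -/
theorem setOf_isErgodicMeasure :
    {μ | IsErgodicMeasure (subshiftAction (F.array m)) μ} = range F.extreme := by
  refine Subset.antisymm (fun μ hμ => ?_) ?_
  · obtain ⟨c, hc1, h⟩ := F.exists_eq_sum_smul_extreme hμ.1
    obtain ⟨a, ha⟩ : ∃ a, c a ≠ 0 := by
      by_contra! h0
      simp [h0] at hc1
    refine ⟨a, hμ.eq_of_absolutelyContinuous (F.extreme_invariant a) ?_⟩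
    intro S hS
    rw [h, Measure.finsetSum_apply, Finset.sum_eq_zero_iff] at hS
    have := hS a (Finset.mem_univ a)
    rw [Measure.smul_apply, ENNReal.smul_def, smul_eq_mul, mul_eq_zero] at this
    exact this.resolve_left (by exact_mod_cast ha)
  · rintro _ ⟨a, rfl⟩
    exact F.isErgodicMeasure_extreme a

end TiledGroup

end VirtToeplitz

namespace VirtToeplitz

/-! ### Densities of periodic positions, and agreement of `eta` with the level array. -/

theorem isInvariantMeasure_smul_add_smul {G A : Type*} [Group G] [TopologicalSpace A]
    [MeasurableSpace A] {x : G → A} {μ ν : Measure (orbitClosure x)}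
    (hμ : IsInvariantMeasure (subshiftAction x) μ) (hν : IsInvariantMeasure (subshiftAction x) ν)
    {a b : NNReal} (hab : a + b = 1) :
    IsInvariantMeasure (subshiftAction x) (a • μ + b • ν) := by
  have := IsInvariantMeasure.sum_smul (ν := ![μ, ν]) (c := ![a, b])
    (by intro i; fin_cases i <;> assumption) (by simpa using hab)
  simpa using this

namespace TiledGroup

open Classical

variable {G V : Type*} [Group G] [AddCommGroup V] (F : TiledGroup G V) {m : ℕ} [NeZero m]

/-! ### Periodic positions -/

/-- Some translates of a gap have level `n` and others level `n + 1`. For `m ≥ 2` these carry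
different symbols, so gaps are not periodic; for `m = 1` only one symbol is available and every gap
is periodic. -/
theorem mem_per_iff {n : ℕ} (hn : 1 ≤ n) {H : Subgroup G}
    (hH : ∀ g, g ∈ H ↔ ∃ γ ∈ F.Λ n, F.emb γ = g) {u : G} (hu : u ∈ F.U n) (a : Fin (m + 1)) :
    u ∈ Per (F.array m) H a ↔ (F.level (F.coord u) < n ∧ F.array m u = a) ∨
      (n ≤ F.level (F.coord u) ∧ m = 1 ∧ a ≠ Fin.last m) := by
  have h1 : u ∈ Per (F.array m) H a ↔ ∀ γ ∈ F.Λ n, F.array m (F.emb γ * u) = a := by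
    constructor
    · intro h γ hγ
      have := h (F.emb (-γ)) ((hH _).2 ⟨-γ, neg_mem hγ, rfl⟩)
      rwa [← F.emb_neg, neg_neg] at this
    · rintro h _ hg
      obtain ⟨γ, hγ, rfl⟩ := (hH _).1 hg
      rw [← F.emb_neg]
      exact h _ (neg_mem hγ)
  rw [h1]
  have harr : ∀ γ, F.array m (F.emb γ * u) =
      levelSymbol m (F.level (γ + F.coord u)) (F.rep u) := fun γ => by
    rw [array, F.coord_emb_mul', F.rep_emb_mul']
  rcases lt_or_ge (F.level (F.coord u)) n with hl | hl
  · simp only [hl, not_le.2 hl, true_and, false_and, or_false]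
    constructor
    · intro h
      simpa [F.emb_zero] using h 0 (F.Λ n).zero_mem
    · intro h γ hγ
      rw [harr, F.level_add_of_lt hγ hl]
      exact h
  · simp only [hl, not_lt.2 hl, true_and, false_and, false_or]
    have hsym : ∀ k, n ≤ k → levelSymbol m k (F.rep u) = (Fin.ofNat m k).castSucc := fun k hk => by
      rw [levelSymbol, if_neg (by omega), alphaSucc]
    constructor
    · intro h
      have hval : ∀ k, n ≤ k → (Fin.ofNat m k).castSucc = a := by
        intro k hk
        obtain ⟨γ, hγ, hk'⟩ := F.exists_level_add_eq hk
        rw [← hsym k hk, ← hk' _ (F.mem_U.1 hu) hl, ← harr]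
        exact h γ hγ
      have h2 := (hval n le_rfl).trans (hval (n + 1) n.le_succ).symm
      rw [Fin.castSucc_inj, Fin.ext_iff] at h2
      have h3 : n ≡ n + 1 [MOD m] := h2
      have h4 : m ∣ 1 := by
        have := (Nat.modEq_iff_dvd' n.le_succ).1 h3
        simpa using this
      refine ⟨Nat.dvd_one.1 h4, ?_⟩
      rw [← hval n le_rfl]
      exact (Fin.castSucc_lt_last _).ne
    · rintro ⟨rfl, ha⟩ γ hγ
      rw [harr, hsym _ ((F.le_level_add_iff hγ _).2 hl)]
      ext
      have h5 : a.1 ≠ 1 := fun h => ha (Fin.ext h)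
      have h6 := (Fin.ofNat 1 (F.level (γ + F.coord u))).2
      have h7 := a.2
      rw [Fin.val_castSucc]
      omega

theorem per_density {n : ℕ} (hn : 1 ≤ n) {H : Subgroup G}
    (hH : ∀ g, g ∈ H ↔ ∃ γ ∈ F.Λ n, F.emb γ = g) (a : Fin (m + 1)) :
    (((F.U n : Set G) ∩ Per (F.array m) H a).ncard : ℝ) / (F.U n).card =
      F.symbolFreq m a n + if m = 1 ∧ a ≠ Fin.last m then F.gap n else 0 := by
  have : (F.U n : Set G) ∩ Per (F.array m) H a =
      ((F.U n).filter (fun u => F.level (F.coord u) < n ∧ F.array m u = a) ∪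
      (F.U n).filter (fun u => n ≤ F.level (F.coord u) ∧ m = 1 ∧ a ≠ Fin.last m) : Finset G) := by
    ext u
    simp only [mem_inter_iff, Finset.mem_coe, Finset.coe_union, Finset.coe_filter, mem_union,
      mem_ofPred_eq, ← and_or_left]
    exact and_congr_right fun hu => F.mem_per_iff hn hH hu a
  rw [this, Set.ncard_coe_finset, Finset.card_union_of_disjoint, symbolFreq_eq, gap_eq]
  · split_ifs with h
    · simp [h, add_div]
    · simp [h]
  · rw [Finset.disjoint_filter]
    intro u _ h1 h2
    omega

omit [NeZero m] in
theorem perAll_density {n : ℕ} {H : Subgroup G} (x : G → Fin (m + 1)) :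
    (((F.U n : Set G) ∩ PerAll x H).ncard : ℝ) / (F.U n).card =
      ∑ a, (((F.U n : Set G) ∩ Per x H a).ncard : ℝ) / (F.U n).card := by
  have hS : ∀ S : Set G, ((F.U n : Set G) ∩ S).ncard = ((F.U n).filter (· ∈ S)).card := by
    intro S
    rw [← Set.ncard_coe_finset]
    congr 1
    ext; simp
  have hx : ∀ {g a}, g ∈ Per x H a → x g = a := fun {g a} h => by simpa using h 1 H.one_mem
  simp_rw [hS]
  rw [← Finset.sum_div, ← Nat.cast_sum]
  congr 2
  rw [Finset.card_eq_sum_card_fiberwise (f := x) (t := Finset.univ) (by simp)]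
  refine Finset.sum_congr rfl fun a _ => ?_
  rw [Finset.filter_filter]
  congr 1
  refine Finset.filter_congr fun u _ => ?_
  simp only [PerAll, mem_iUnion]
  constructor
  · rintro ⟨⟨b, hb⟩, rfl⟩
    rwa [hx hb]
  · exact fun h => ⟨⟨a, h⟩, hx h⟩

/-- The limit density of the periodic positions of a symbol. -/
noncomputable def perFreq (m : ℕ) [NeZero m] (a : Fin (m + 1)) : ℝ :=
  F.limFreq m a + if m = 1 ∧ a ≠ Fin.last m then F.limGap else 0

/-- For `m ≥ 2` one has `1 - d = limGap`. For `m = 1` the gaps are already counted in `t_1` and `d =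
1`, so the two descriptions of the vertex still agree. -/
theorem vertex_perFreq (i : Fin m) :
    vertex (F.perFreq m) (∑ a, F.perFreq m a) i = F.extremeVec i := by
  have hd : ∑ a, F.perFreq m a = 1 - F.limGap + if m = 1 then F.limGap else 0 := by
    simp only [perFreq, Finset.sum_add_distrib, sum_limFreq]
    congr 1
    rw [Fin.sum_univ_castSucc]
    by_cases h : m = 1
    · subst h; simp
    · simp [h]
  funext a
  rw [vertex, hd, extremeVec]
  by_cases hm : m = 1
  · subst hm
    by_cases ha : a = Fin.last 1
    · subst ha
      have : (Fin.last 1 : Fin (1 + 1)) ≠ i.castSucc := (Fin.castSucc_lt_last i).ne'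
      rw [if_neg this, if_neg this, perFreq, if_neg (by simp)]
    · have h : a = i.castSucc := by
        have h1 : a.1 ≠ 1 := fun h => ha (Fin.ext h)
        ext
        rw [Fin.val_castSucc]
        omega
      rw [if_pos h, if_pos rfl, if_pos h, perFreq, if_pos ⟨rfl, ha⟩]
      ring
  · simp only [perFreq, hm, false_and, if_false, add_zero]
    split_ifs <;> ring

/-! ### Comparison with the definition by steps -/

variable {Γ : ℕ → Subgroup G} {D : ℕ → Finset G}

section Comparison

variable (hΓ : ∀ n, 1 ≤ n → ∀ g, g ∈ Γ n ↔ ∃ γ ∈ F.Λ n, F.emb γ = g)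
  (hD : ∀ n, 1 ≤ n → ∀ g, g ∈ D n ↔ ∃ v ∈ F.B n, F.emb v = g) (hB : F.B 0 = {0})

include hD in
theorem DR_eq_U {n : ℕ} (hn : 1 ≤ n) : DR D F.R n = F.U n := by
  ext g
  simp only [DR, Finset.mem_mul, U, Finset.mem_image, Finset.mem_product, Prod.exists, hD n hn]
  constructor
  · rintro ⟨_, ⟨v, hv, rfl⟩, r, hr, rfl⟩
    exact ⟨v, r, ⟨hv, hr⟩, rfl⟩
  · rintro ⟨v, r, ⟨hv, hr⟩, rfl⟩
    exact ⟨_, ⟨v, hv, rfl⟩, r, hr, rfl⟩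

theorem coord_emb (v : V) : F.coord (F.emb v) = v := by
  rw [← mul_one (F.emb v), F.coord_emb_mul _ _ F.one_mem]

theorem rep_emb (v : V) : F.rep (F.emb v) = 1 := by
  rw [← mul_one (F.emb v), F.rep_emb_mul _ _ F.one_mem]

theorem exists_emb_eq_iff {S : Set V} {g : G} :
    (∃ v ∈ S, F.emb v = g) ↔ F.rep g = 1 ∧ F.coord g ∈ S := by
  constructor
  · rintro ⟨v, hv, rfl⟩
    exact ⟨F.rep_emb v, by rwa [F.coord_emb]⟩
  · rintro ⟨h, hv⟩
    refine ⟨_, hv, ?_⟩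
    conv_rhs => rw [← F.emb_mul_rep g, h, mul_one]

-- Points of level `n` form a `Λ (n + 1)`-periodic set, and each of them has a representative in `B
-- n`.
include hΓ in
theorem mem_mul_of_mem_iff {n : ℕ} {S : Set G}
    (hS : ∀ g, g ∈ S ↔ F.rep g = 1 ∧ F.coord g ∈ F.B n ∧ F.level (F.coord g) = n) (g : G) :
    g ∈ (Γ (n + 1) : Set G) * S ↔ F.rep g = 1 ∧ F.level (F.coord g) = n := by
  rw [Set.mem_mul]
  constructor
  · rintro ⟨_, hγ, s, hs, rfl⟩
    obtain ⟨γ, hγ', rfl⟩ := (hΓ _ (by omega) _).1 hγ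
    obtain ⟨h1, h2, h3⟩ := (hS s).1 hs
    rw [F.rep_emb_mul', F.coord_emb_mul', F.level_add_of_lt (n := n + 1) hγ' (by omega)]
    exact ⟨h1, h3⟩
  · rintro ⟨h1, h2⟩
    obtain ⟨d, hd, h⟩ := F.mem_E_level (F.coord g)
    rw [h2] at hd h
    have e : d = -(F.coord g - d) + F.coord g := by abel
    refine ⟨_, (hΓ _ (by omega) _).2 ⟨_, h, rfl⟩, F.emb d, (hS _).2 ?_, ?_⟩
    · rw [F.rep_emb, F.coord_emb]
      refine ⟨rfl, hd, ?_⟩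
      rw [e, F.level_add_of_lt (n := n + 1) (neg_mem h) (by omega), h2]
    · rw [← F.emb_add, sub_add_cancel]
      conv_rhs => rw [← F.emb_mul_rep g, h1, mul_one]

-- Strong induction: the sets removed from `D_n` are the points of `G'` of level below `n`, and
-- points of `B n` have level at most `n`.
include hΓ hD hB in
theorem mem_J_iff (n : ℕ) (g : G) :
    g ∈ J Γ D n ↔ F.rep g = 1 ∧ F.coord g ∈ F.B n ∧ F.level (F.coord g) = n := by
  induction n using Nat.strong_induction_on generalizing g with
  | _ n ih =>
    cases n with
    | zero =>
      rw [J, hB, mem_singleton_iff, Finset.mem_singleton]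
      constructor
      · rintro rfl
        have h := F.coord_of_mem F.one_mem
        refine ⟨F.rep_of_mem F.one_mem, h, ?_⟩
        rw [h]
        exact Nat.le_zero.1 (F.level_le (F.zero_mem 0))
      · rintro ⟨h1, h2, -⟩
        rw [← F.emb_mul_rep g, h1, h2, F.emb_zero, mul_one]
    | succ n =>
      have hU : g ∈ ⋃ i : Fin (n + 1), (Γ (i.1 + 1) : Set G) * J Γ D i.1 ↔
          F.rep g = 1 ∧ F.level (F.coord g) < n + 1 := by
        simp only [mem_iUnion, F.mem_mul_of_mem_iff hΓ (ih _ (Fin.is_lt _))]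
        exact ⟨fun ⟨i, h1, h2⟩ => ⟨h1, h2 ▸ i.2⟩, fun ⟨h1, h2⟩ => ⟨⟨_, h2⟩, h1, rfl⟩⟩
      have hDg : g ∈ D (n + 1) ↔ F.rep g = 1 ∧ F.coord g ∈ F.B (n + 1) := by
        rw [hD _ (by omega)]
        exact F.exists_emb_eq_iff (S := F.B (n + 1))
      rw [J, Set.mem_sdiff, Finset.mem_coe, hU, hDg]
      constructor
      · rintro ⟨⟨h1, h2⟩, h3⟩
        exact ⟨h1, h2, le_antisymm (F.level_le h2) (not_lt.1 fun h => h3 ⟨h1, h⟩)⟩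
      · rintro ⟨h1, h2, h3⟩
        exact ⟨⟨h1, h2⟩, fun h => by omega⟩

include hΓ hD hB in
theorem mem_stepSet_iff (n : ℕ) (g : G) :
    g ∈ stepSet Γ D F.R n ↔ F.level (F.coord g) = n := by
  rw [stepSet, Set.mem_mul]
  simp only [F.mem_mul_of_mem_iff hΓ (F.mem_J_iff hΓ hD hB n)]
  constructor
  · rintro ⟨s, ⟨h1, h2⟩, r, hr, rfl⟩
    rw [← F.emb_mul_rep s, h1, mul_one, F.coord_emb_mul _ _ hr, h2]
  · intro h
    exact ⟨F.emb (F.coord g), ⟨F.rep_emb _, by rwa [F.coord_emb]⟩, _, F.rep_mem g,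
      F.emb_mul_rep g⟩

include hΓ hB in
theorem mem_mul_diff_iff (g : G) :
    g ∈ (Γ 1 : Set G) * ((F.R : Set G) \ {1}) ↔ F.level (F.coord g) = 0 ∧ F.rep g ≠ 1 := by
  have h0 : F.level 0 = 0 := Nat.le_zero.1 (F.level_le (F.zero_mem 0))
  rw [Set.mem_mul]
  constructor
  · rintro ⟨_, hγ, r, ⟨hr, hr1⟩, rfl⟩
    obtain ⟨γ, hγ', rfl⟩ := (hΓ _ le_rfl _).1 hγ
    rw [F.coord_emb_mul _ _ hr, F.rep_emb_mul _ _ hr]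
    refine ⟨?_, hr1⟩
    rw [← add_zero γ, F.level_add_of_lt (n := 1) hγ' (by omega), h0]
  · rintro ⟨h1, h2⟩
    obtain ⟨d, hd, h⟩ := F.mem_E_level (F.coord g)
    rw [h1] at hd h
    rw [hB, Finset.mem_singleton] at hd
    rw [hd, sub_zero] at h
    exact ⟨_, (hΓ _ le_rfl _).2 ⟨_, h, rfl⟩, _, ⟨F.rep_mem g, h2⟩, F.emb_mul_rep g⟩

include hΓ hD hB in
theorem eta_eq_array : eta Γ D F.R m = F.array m := by
  funext g
  have hex : ∃ n, g ∈ stepSet Γ D F.R n := ⟨_, (F.mem_stepSet_iff hΓ hD hB _ g).2 rfl⟩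
  have hfind : Nat.find hex = F.level (F.coord g) :=
    ((F.mem_stepSet_iff hΓ hD hB _ g).1 (Nat.find_spec hex)).symm
  rw [eta, array, levelSymbol]
  simp only [F.mem_mul_diff_iff hΓ hB]
  split_ifs with h
  · rfl
  · rw [← hfind]

-- On `U n` the array `η_n` agrees with `η`, whose gaps there have level exactly `n`. Averages then
-- depend on `η_n` only through this block, up to the boundary.
include hΓ hD hB in
theorem hasType_etaPeriodic {n : ℕ} (hn : 1 ≤ n) :
    F.HasType n (Fin.ofNat m n) (etaPeriodic Γ D F.R m n) := by
  intro u hu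
  rw [← F.hasType_array hn u hu]
  have hex : ∃ v ∈ DR D F.R n, u * v⁻¹ ∈ Γ n := by
    refine ⟨u, ?_, by simp⟩
    rwa [F.DR_eq_U hD hn]
  rw [etaPeriodic, dif_pos hex, F.eta_eq_array hΓ hD hB]
  obtain ⟨h1, h2⟩ := hex.choose_spec
  have h1' := (F.DR_eq_U hD hn).le h1
  obtain ⟨γ, hγ, e⟩ := (hΓ n hn _).1 h2
  rw [(F.eq_of_emb_mul_eq hγ h1' hu (by rw [e, inv_mul_cancel_right])).2]

include hD in
theorem integral_periodicMeasure [Countable G] {n : ℕ} (hn : 1 ≤ n)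
    (f : C(G → Fin (m + 1), ℝ)) :
    ∫ x, f x ∂(periodicMeasure Γ D F.R m n) = F.avg n f (etaPeriodic Γ D F.R m n) := by
  have hf : Measurable f := f.continuous.measurable
  rw [periodicMeasure, F.DR_eq_U hD hn, integral_smul_measure, integral_finsetSum_measure
    fun u _ => integrable_of_abs_le hf fun y => f.norm_coe_le_norm _]
  simp_rw [integral_dirac' _ _ hf.stronglyMeasurable]
  rw [avg, div_eq_inv_mul]
  simp

end Comparison

end TiledGroup

end VirtToeplitz

namespace VirtToeplitz

/-! ### Lattices and boxes in `ℤ^r` form a box tower. -/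

section IntLattice

variable {r : ℕ}

theorem mem_lattice {p : Fin r → ℕ} {v : Fin r → ℤ} : v ∈ lattice p ↔ ∀ j, (p j : ℤ) ∣ v j := by
  simp [lattice, AddSubgroup.mem_pi, Int.mem_zmultiples_iff]

theorem mem_box {q₁ q₂ : Fin r → ℕ} {v : Fin r → ℤ} :
    v ∈ box q₁ q₂ ↔ ∀ j, -(q₁ j : ℤ) ≤ v j ∧ v j < q₂ j := by
  simp [box]

theorem card_box {p q₁ q₂ : Fin r → ℕ} (hq : ∀ j, q₁ j + q₂ j = p j) :
    (box q₁ q₂).card = ∏ j, p j := by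
  rw [box, Fintype.card_piFinset]
  refine Finset.prod_congr rfl fun j _ => ?_
  rw [Int.card_Ico, ← hq j]
  omega

theorem relIndex_lattice_mul {p p' : Fin r → ℕ} (h : ∀ j, p j ∣ p' j) :
    (lattice p').relIndex (lattice p) * ∏ j, p j = ∏ j, p' j := by
  have hi : ∀ p : Fin r → ℕ, (lattice p).index = ∏ j, p j := fun p => by
    rw [lattice, AddSubgroup.index_pi]
    simp
  rw [← hi, ← hi]
  refine AddSubgroup.relIndex_mul_index fun v hv => ?_
  rw [mem_lattice] at hv ⊢
  exact fun j => (Int.natCast_dvd_natCast.2 (h j)).trans (hv j)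

theorem exists_mem_box_sub_mem_lattice {p q₁ q₂ : Fin r → ℕ} (hq : ∀ j, q₁ j + q₂ j = p j)
    (hp : ∀ j, 0 < p j) (v : Fin r → ℤ) : ∃ d ∈ box q₁ q₂, v - d ∈ lattice p := by
  refine ⟨fun j => (v j + q₁ j) % (p j : ℤ) - q₁ j, mem_box.2 fun j => ?_,
    mem_lattice.2 fun j => ?_⟩
  · have hp' : (0 : ℤ) < p j := by exact_mod_cast hp j
    have h1 := Int.emod_nonneg (v j + q₁ j) hp'.ne'
    have h2 := Int.emod_lt_of_pos (v j + q₁ j) hp'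
    have h3 : (q₁ j : ℤ) + q₂ j = p j := by exact_mod_cast hq j
    constructor <;> linarith
  · have := Int.dvd_self_sub_emod (x := v j + q₁ j) (m := (p j : ℤ))
    convert this using 1
    simp only [Pi.sub_apply]
    ring

theorem eq_of_sub_mem_lattice {p q₁ q₂ : Fin r → ℕ} (hq : ∀ j, q₁ j + q₂ j = p j)
    {d d' : Fin r → ℤ} (hd : d ∈ box q₁ q₂) (hd' : d' ∈ box q₁ q₂) (h : d - d' ∈ lattice p) :
    d = d' := by
  rw [mem_box] at hd hd'
  rw [mem_lattice] at h
  funext j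
  have h3 : (q₁ j : ℤ) + q₂ j = p j := by exact_mod_cast hq j
  have := hd j
  have := hd' j
  refine sub_eq_zero.1 (Int.eq_zero_of_abs_lt_dvd (h j) ?_)
  rw [abs_lt]
  constructor <;> linarith

theorem card_filter_add_notMem_Ico_le (a b w : ℤ) :
    ((Finset.Ico a b).filter fun x => x + w ∉ Finset.Ico a b).card ≤ w.natAbs := by
  have hsub : ((Finset.Ico a b).filter fun x => x + w ∉ Finset.Ico a b) ⊆
      if 0 ≤ w then Finset.Ico (b - w) b else Finset.Ico a (a - w) := by
    intro x hx
    simp only [Finset.mem_filter, Finset.mem_Ico] at hx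
    split_ifs <;> rw [Finset.mem_Ico] <;> omega
  refine (Finset.card_le_card hsub).trans ?_
  split_ifs <;> rw [Int.card_Ico] <;> omega

/-- Union bound over the coordinate `j` in which `d + w` leaves the box: at most `|w j|` of the `p
j` values of that coordinate are bad, the others being free. -/
theorem card_boundary_box_le {p q₁ q₂ : Fin r → ℕ} (hq : ∀ j, q₁ j + q₂ j = p j)
    (hp : ∀ j, 0 < p j) (w : Fin r → ℤ) :
    (({d ∈ (box q₁ q₂ : Set (Fin r → ℤ)) | d + w ∉ box q₁ q₂}).ncard : ℝ) / (box q₁ q₂).card ≤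
      ∑ j, ((w j).natAbs : ℝ) / p j := by
  classical
  have hcard : (0 : ℝ) < (box q₁ q₂).card := by
    rw [card_box hq]
    exact_mod_cast Finset.prod_pos fun j _ => hp j
  set I : Fin r → Finset ℤ := fun j => Finset.Ico (-(q₁ j : ℤ)) (q₂ j : ℤ) with hI
  set S : Fin r → Finset ℤ := fun j => (I j).filter fun x => x + w j ∉ I j with hS
  have hsub : {d ∈ (box q₁ q₂ : Set (Fin r → ℤ)) | d + w ∉ box q₁ q₂} ⊆
      (Finset.univ.biUnion fun j => Fintype.piFinset (Function.update I j (S j)) :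
        Finset (Fin r → ℤ)) := by
    rintro d ⟨hd, hdw⟩
    rw [Finset.mem_coe, box, Fintype.mem_piFinset] at hd
    rw [box, Fintype.mem_piFinset] at hdw
    push Not at hdw
    obtain ⟨j, hj⟩ := hdw
    simp only [Finset.coe_biUnion, mem_iUnion, Finset.mem_coe, Fintype.mem_piFinset]
    refine ⟨j, Finset.mem_univ j, fun i => ?_⟩
    by_cases h : i = j
    · subst h
      rw [Function.update_self]
      exact Finset.mem_filter.2 ⟨hd i, hj⟩
    · rw [Function.update_of_ne h]
      exact hd i
  have hle := (Set.ncard_le_ncard hsub (Finset.finite_toSet _))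
  rw [Set.ncard_coe_finset] at hle
  have hle' := hle.trans Finset.card_biUnion_le
  rw [div_le_iff₀ hcard, Finset.sum_mul]
  refine (Nat.cast_le.2 hle').trans ?_
  rw [Nat.cast_sum]
  refine Finset.sum_le_sum fun j _ => ?_
  have hpj : (0 : ℝ) < p j := by exact_mod_cast hp j
  have hIc : ∀ i, (I i).card = p i := fun i => by
    rw [hI, Int.card_Ico, ← hq i]; omega
  rw [Fintype.card_piFinset, card_box hq, ← Finset.mul_prod_erase _ _ (Finset.mem_univ j),
    ← Finset.mul_prod_erase _ p (Finset.mem_univ j), Function.update_self]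
  rw [Finset.prod_congr rfl fun i hi => by
    rw [Function.update_of_ne (Finset.ne_of_mem_erase hi), hIc]]
  push_cast
  have hSj : ((S j).card : ℝ) ≤ (w j).natAbs :=
    Nat.cast_le.2 (card_filter_add_notMem_Ico_le _ _ _)
  rw [← mul_assoc, div_mul_cancel₀ _ hpj.ne']
  gcongr

/-- The growth condition says that the `i`-th factor is at least `2 ^ (-(1/2)^(i+1))` for `i ≥ 1`;
the exponents sum to `-1/2`. The factor `1/2` accounts for `i = 0`. -/
theorem le_prod_of_index_bound {b : ℕ → ℕ} (hb : ∀ i, 0 < b i) (h0 : 2 * b 0 ≤ b 1)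
    (h : ∀ i, 1 ≤ i → ∃ k : ℕ, b (i + 1) = k * b i ∧
      1 / (1 - 1 / (2 : ℝ) ^ ((1 / 2 : ℝ) ^ (i + 1))) < k) (n : ℕ) :
    1 / 2 * (2 : ℝ) ^ (-(1 / 2) : ℝ) ≤
      ∏ i ∈ Finset.range n, (1 - (b i : ℝ) / b (i + 1)) := by
  have hfac : ∀ i, 1 ≤ i → (2 : ℝ) ^ (-(1 / 2 : ℝ) ^ (i + 1)) ≤ 1 - (b i : ℝ) / b (i + 1) := by
    intro i hi
    obtain ⟨k, hk, hlt⟩ := h i hi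
    have hbi : (0 : ℝ) < b i := by exact_mod_cast hb i
    have hpow : (1 : ℝ) < 2 ^ ((1 / 2 : ℝ) ^ (i + 1)) :=
      Real.one_lt_rpow one_lt_two (by positivity)
    have hx : 1 / (2 : ℝ) ^ ((1 / 2 : ℝ) ^ (i + 1)) < 1 := by
      rw [div_lt_one (by linarith)]; exact hpow
    have hpos : 0 < 1 / (1 - 1 / (2 : ℝ) ^ ((1 / 2 : ℝ) ^ (i + 1))) :=
      one_div_pos.2 (by linarith)
    have hk0 : (0 : ℝ) < k := hpos.trans hlt
    have h1 : 1 / (k : ℝ) < 1 - 1 / (2 : ℝ) ^ ((1 / 2 : ℝ) ^ (i + 1)) := by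
      rw [one_div_lt hk0 (by linarith)]; exact hlt
    rw [hk, Nat.cast_mul, div_mul_cancel_right₀ hbi.ne', Real.rpow_neg zero_le_two, ← one_div,
      ← one_div]
    linarith
  -- The exponent is minus the partial geometric sum of `(1/2)^(i+1)` over `1 ≤ i ≤ n`.
  have hind : ∀ n, (1 : ℝ) / 2 * 2 ^ ((1 / 2 : ℝ) ^ (n + 1) - 1 / 2) ≤
      ∏ i ∈ Finset.range (n + 1), (1 - (b i : ℝ) / b (i + 1)) := by
    intro n
    induction n with
    | zero =>
      have h1 : (0 : ℝ) < b 1 := by exact_mod_cast hb 1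
      have h2 : 2 * (b 0 : ℝ) ≤ b 1 := by exact_mod_cast h0
      have h3 : (b 0 : ℝ) / b 1 ≤ 1 / 2 := by rw [div_le_iff₀ h1]; linarith
      simp only [zero_add, pow_one, sub_self, Real.rpow_zero, Finset.range_one,
        Finset.prod_singleton]
      linarith
    | succ n ih =>
      rw [Finset.prod_range_succ]
      calc (1 : ℝ) / 2 * 2 ^ ((1 / 2 : ℝ) ^ (n + 1 + 1) - 1 / 2)
          = (1 / 2 * 2 ^ ((1 / 2 : ℝ) ^ (n + 1) - 1 / 2)) *
              2 ^ (-(1 / 2 : ℝ) ^ (n + 1 + 1)) := by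
            rw [mul_assoc, ← Real.rpow_add zero_lt_two]
            congr 2
            rw [pow_succ _ (n + 1)]
            ring
        _ ≤ _ := mul_le_mul ih (hfac _ (by omega)) (by positivity) (le_trans (by positivity) ih)
  cases n with
  | zero =>
    have : (2 : ℝ) ^ (-(1 / 2) : ℝ) ≤ 1 :=
      Real.rpow_le_one_of_one_le_of_nonpos one_le_two (by norm_num)
    rw [Finset.prod_range_zero]
    linarith
  | succ n =>
    refine le_trans ?_ (hind n)
    gcongr
    · exact one_le_two
    · have : (0 : ℝ) ≤ (1 / 2) ^ (n + 1) := by positivity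
      linarith

/-- The tower of lattices and boxes in `ℤ^r`, completed by the trivial box at index `0`. -/
noncomputable def latticeTower (hr : 1 ≤ r) (p q₁ q₂ : ℕ → Fin r → ℕ)
    (hp_dvd : ∀ i, 1 ≤ i → ∀ j, p i j ∣ p (i + 1) j)
    (hp_large : ∀ i, 1 ≤ i → ∀ j, 2 * i + 1 < p i j)
    (hindex : ∀ i, 1 ≤ i →
      1 / (1 - 1 / (2 : ℝ) ^ ((1 / 2 : ℝ) ^ (i + 1))) <
        ((lattice (p (i + 1))).relIndex (lattice (p i)) : ℝ))
    (hq₁ : ∀ i, 1 ≤ i → ∀ j, i < q₁ i j)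
    (hq₂ : ∀ i, 1 ≤ i → ∀ j, i < q₂ i j)
    (hq : ∀ i, 1 ≤ i → ∀ j, q₁ i j + q₂ i j = p i j)
    (htile : ∀ i, 1 ≤ i →
      (box (q₁ (i + 1)) (q₂ (i + 1)) : Set (Fin r → ℤ)) =
        ⋃ γ ∈ (box (q₁ (i + 1)) (q₂ (i + 1)) : Set (Fin r → ℤ)) ∩
            (lattice (p i) : Set (Fin r → ℤ)),
          (fun v => γ + v) '' (box (q₁ i) (q₂ i) : Set (Fin r → ℤ))) :
    BoxTower (Fin r → ℤ) where
  Λ n := if n = 0 then ⊤ else lattice (p n)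
  B n := if n = 0 then {0} else box (q₁ n) (q₂ n)
  anti n := by
    rcases Nat.eq_zero_or_pos n with rfl | hn
    · simp
    · rw [if_neg (by omega), if_neg (by omega)]
      intro v hv
      rw [mem_lattice] at hv ⊢
      exact fun j => (Int.natCast_dvd_natCast.2 (hp_dvd n hn j)).trans (hv j)
  zero_mem n := by
    split_ifs with h
    · simp
    · rw [mem_box]
      intro j
      have := hq₂ n (by omega) j
      simp only [Pi.zero_apply]
      omega
  exists_rep n v := by
    split_ifs with h
    · exact ⟨0, by simp, AddSubgroup.mem_top _⟩
    · exact exists_mem_box_sub_mem_lattice (hq n (by omega))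
        (fun j => by have := hp_large n (by omega) j; omega) v
  unique n d hd d' hd' h := by
    split_ifs at hd hd' h with hn
    · rw [Finset.mem_singleton] at hd hd'
      rw [hd, hd']
    · exact eq_of_sub_mem_lattice (hq n (by omega)) hd hd' h
  tile n γ hγ d hd := by
    rcases Nat.eq_zero_or_pos n with rfl | hn
    · rw [if_pos rfl, Finset.mem_singleton] at hd
      rw [hd, add_zero]
    · rw [if_neg (by omega)] at hγ hd
      rw [if_neg (by omega)]
      have ht := fun v => Set.ext_iff.1 (htile n hn) v
      simp only [mem_iUnion, mem_inter_iff, mem_image, SetLike.mem_coe,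
        exists_prop] at ht
      constructor
      · intro h
        obtain ⟨γ', ⟨h1, h2⟩, d', hd', e⟩ := (ht _).1 h
        -- Both are representatives in the box of the same class modulo the lattice, so the tile
        -- containing `γ + d` is the one translated by `γ`.
        have hdd : d' = d := by
          refine eq_of_sub_mem_lattice (hq n hn) hd' hd ?_
          have e' : d' - d = γ - γ' := by
            rw [sub_eq_sub_iff_add_eq_add, add_comm d', e]
          rw [e']
          exact sub_mem hγ h2
        rw [hdd] at e
        rwa [← add_right_cancel e]
      · exact fun h => (ht _).2 ⟨γ, ⟨h, hγ⟩, d, hd, rfl⟩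
  exhaust v := by
    -- Both `q₁` and `q₂` exceed their index, so this box contains `v`; the summand `1` avoids the
    -- artificial box at index `0`.
    refine ⟨1 + ∑ j, (v j).natAbs, ?_⟩
    rw [if_neg (by omega), mem_box]
    intro j
    have h1 : (v j).natAbs ≤ ∑ j, (v j).natAbs :=
      Finset.single_le_sum (f := fun j => (v j).natAbs) (fun _ _ => zero_le) (Finset.mem_univ j)
    have h2 := hq₁ (1 + ∑ j, (v j).natAbs) (by omega) j
    have h3 := hq₂ (1 + ∑ j, (v j).natAbs) (by omega) j
    omega
  folner w := by
    have hlim : Tendsto (fun n : ℕ => (∑ j, ((w j).natAbs : ℝ)) / (n : ℝ)) atTop (𝓝 0) :=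
      tendsto_const_nhds.div_atTop tendsto_natCast_atTop_atTop
    refine tendsto_of_tendsto_of_tendsto_of_le_of_le' tendsto_const_nhds hlim
      (Eventually.of_forall fun n => by positivity) ?_
    filter_upwards [eventually_ge_atTop 1] with n hn
    rw [if_neg (by omega)]
    refine (card_boundary_box_le (hq n hn)
      (fun j => by have := hp_large n hn j; omega) w).trans ?_
    rw [Finset.sum_div]
    refine Finset.sum_le_sum fun j _ => ?_
    have hn0 : (0 : ℝ) < n := by exact_mod_cast hn
    have : (n : ℝ) ≤ p n j := by
      have := hp_large n hn j
      exact_mod_cast (by omega : n ≤ p n j)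
    gcongr
  prod_bound := by
    have hpos : ∀ n, 1 ≤ n → 0 < ∏ j, p n j := fun n hn =>
      Finset.prod_pos fun j _ => by have := hp_large n hn j; omega
    refine ⟨1 / 2 * (2 : ℝ) ^ (-(1 / 2) : ℝ), by positivity,
      le_prod_of_index_bound (b := fun n => (if n = 0 then {0} else box (q₁ n) (q₂ n)).card)
        (fun n => ?_) ?_ fun n hn => ?_⟩
    · split_ifs with h
      · simp
      · rw [card_box (hq n (by omega))]
        exact hpos n (by omega)
    -- The artificial first step from `{0}` to the box at index `1` has ratio at least `2`, because
    -- every `p 1 j` exceeds `3`.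
    · simp only [if_true, Finset.card_singleton, one_ne_zero, if_false, card_box (hq 1 le_rfl)]
      have h1 : p 1 ⟨0, hr⟩ ∣ ∏ j, p 1 j := Finset.dvd_prod_of_mem _ (Finset.mem_univ _)
      have h2 := Nat.le_of_dvd (hpos 1 le_rfl) h1
      have h3 := hp_large 1 le_rfl ⟨0, hr⟩
      omega
    · refine ⟨_, ?_, hindex n hn⟩
      simp only [Nat.add_eq_zero_iff, one_ne_zero, and_false, if_false,
        card_box (hq (n + 1) (by omega))]
      rw [if_neg (by omega), card_box (hq n hn)]
      exact (relIndex_lattice_mul (hp_dvd n hn)).symm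

end IntLattice

/-- The tiled group given by a box tower on a subgroup and a set of coset representatives. -/
noncomputable def tiledGroupOfComplement {G V : Type*} [Group G] [AddCommGroup V]
    {G' : Subgroup G} (e : Multiplicative V ≃* G') {R : Finset G} (hR1 : (1 : G) ∈ R)
    (hR : Subgroup.IsComplement (G' : Set G) (R : Set G)) (T : BoxTower V) : TiledGroup G V where
  toBoxTower := T
  emb v := (e (Multiplicative.ofAdd v) : G')
  emb_add v w := by rw [ofAdd_add, map_mul, Subgroup.coe_mul]
  R := R
  one_mem := hR1
  coord g := Multiplicative.toAdd (e.symm (hR.existsUnique g).choose.1)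
  rep g := (hR.existsUnique g).choose.2
  rep_mem g := (hR.existsUnique g).choose.2.2
  emb_mul_rep g := by
    rw [ofAdd_toAdd, MulEquiv.apply_symm_apply]
    exact (hR.existsUnique g).choose_spec.1
  coord_emb_mul v r hr := by
    have h := hR.existsUnique ((e (Multiplicative.ofAdd v) : G') * r)
    have := h.choose_spec.2 (e (Multiplicative.ofAdd v), ⟨r, hr⟩) rfl
    change Multiplicative.toAdd (e.symm h.choose.1) = v
    rw [← this, MulEquiv.symm_apply_apply, toAdd_ofAdd]
  rep_emb_mul v r hr := by
    have h := hR.existsUnique ((e (Multiplicative.ofAdd v) : G') * r)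
    have := h.choose_spec.2 (e (Multiplicative.ofAdd v), ⟨r, hr⟩) rfl
    change (h.choose.2 : G) = r
    rw [← this]

end VirtToeplitz

namespace VirtToeplitz

/-! ### Assembly for the concrete array. -/

/-- The measures live on a type depending on the array, so all results are transported together by
one substitution along `x = F.array m`. -/
theorem TiledGroup.exists_ergodic_measures {G V : Type*} [Group G] [AddCommGroup V] [Countable G]
    (F : TiledGroup G V) {m : ℕ} [NeZero m] {x : G → Fin (m + 1)} (hx : x = F.array m) :
    ∃ ν : Fin m → Measure (orbitClosure x), Function.Injective ν ∧
      {μ | IsErgodicMeasure (subshiftAction x) μ} = range ν ∧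
      (∀ (i : Fin m) (f : C(G → Fin (m + 1), ℝ)) (ε : ℝ), 0 < ε → ∀ᶠ n in atTop, ∀ z,
        F.HasType n i z → |F.avg n f z - ∫ y, f y.1 ∂(ν i)| < ε) ∧
      (∀ i, (fun a => (ν i).real {y | y.1 1 = a}) = F.extremeVec i) ∧
      BijOn (fun (μ : Measure (orbitClosure x)) a => μ.real {y | y.1 1 = a})
        {μ | IsInvariantMeasure (subshiftAction x) μ}
        (convexHull ℝ (range (F.extremeVec : Fin m → _))) := by
  subst hx
  exact ⟨F.extreme, F.extreme_injective, F.setOf_isErgodicMeasure,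
    fun i f ε hε => F.tendsto_avg (F.extreme_invariant i) (F.symbols_extreme i) f hε,
    F.symbols_extreme, F.bijOn_symbols⟩

end VirtToeplitz

theorem corollary4p20
    {G : Type*} [Group G] [Countable G]
    -- the normal finite index subgroup `G'` isomorphic to `ℤ^r`
    (G' : Subgroup G) [G'.Normal] [G'.FiniteIndex]
    (r : ℕ) (hr : 1 ≤ r) (e : Multiplicative (Fin r → ℤ) ≃* G')
    -- a set `R` of representatives of `G/G'` with `1 ∈ R`
    (R : Finset G) (hR1 : (1 : G) ∈ R)
    (hR : Subgroup.IsComplement (G' : Set G) (R : Set G))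
    -- the sequences defining the lattices `Γ_i` and the boxes `D_i`, `i ≥ 1`
    (p q₁ q₂ : ℕ → Fin r → ℕ)
    (hp_mono : ∀ i, 1 ≤ i → ∀ j, p i j < p (i + 1) j)
    (hp_dvd : ∀ i, 1 ≤ i → ∀ j, p i j ∣ p (i + 1) j)
    (hp_large : ∀ i, 1 ≤ i → ∀ j, 2 * i + 1 < p i j)
    (hindex : ∀ i, 1 ≤ i →
      1 / (1 - 1 / (2 : ℝ) ^ ((1 / 2 : ℝ) ^ (i + 1))) <
        ((lattice (p (i + 1))).relIndex (lattice (p i)) : ℝ))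
    (hq₁ : ∀ i, 1 ≤ i → ∀ j, i < q₁ i j)
    (hq₂ : ∀ i, 1 ≤ i → ∀ j, i < q₂ i j)
    (hq : ∀ i, 1 ≤ i → ∀ j, q₁ i j + q₂ i j = p i j)
    (htile : ∀ i, 1 ≤ i →
      (box (q₁ (i + 1)) (q₂ (i + 1)) : Set (Fin r → ℤ)) =
        ⋃ γ ∈ (box (q₁ (i + 1)) (q₂ (i + 1)) : Set (Fin r → ℤ)) ∩
            (lattice (p i) : Set (Fin r → ℤ)),
          (fun v => γ + v) '' (box (q₁ i) (q₂ i) : Set (Fin r → ℤ)))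
    (m : ℕ) [NeZero m] :
    let Γ : ℕ → Subgroup G := fun i => latticeIn e (p i)
    let D : ℕ → Finset G := fun i => boxIn e (q₁ i) (q₂ i)
    let η : G → Fin (m + 1) := eta Γ D R m
    let φ : G → ToeplitzSubshift Γ D R m → ToeplitzSubshift Γ D R m := subshiftAction η
    ∃ (t : Fin (m + 1) → ℝ) (d : ℝ) (ν : Fin m → Measure (ToeplitzSubshift Γ D R m)),
      -- `t_a` and `d` are the limit densities of the periodic positions
      (∀ a, Tendsto (fun n => density D R n (Per η (Γ n) a)) atTop (𝓝 (t a))) ∧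
      Tendsto (fun n => density D R n (PerAll η (Γ n))) atTop (𝓝 d) ∧
      -- there are exactly `m` ergodic measures, `ν_1, …, ν_m`
      Function.Injective ν ∧
      {μ | IsErgodicMeasure φ μ} = Set.range ν ∧
      -- `ν_j` is the weak limit of the periodic measures `μ_{j + s m - 1}` (here `j = i + 1`)
      (∀ (i : Fin m) (f : C(G → Fin (m + 1), ℝ)),
        Tendsto (fun s : ℕ => ∫ x, f x ∂(periodicMeasure Γ D R m (i.1 + s * m))) atTop
          (𝓝 (∫ x, f x.1 ∂(ν i)))) ∧
      -- `μ ↦ (μ([1]), …, μ([m]), μ([β]))` is an affine bijection from the invariant measures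
      -- onto the simplex with vertices `vertex t d i`, and it maps `ν_i` to the `i`-th vertex
      LinearIndependent ℝ (vertex t d : Fin m → Fin (m + 1) → ℝ) ∧
      (∀ i, symbolVector Γ D R m (ν i) = vertex t d i) ∧
      Set.BijOn (symbolVector Γ D R m) {μ | IsInvariantMeasure φ μ}
        (convexHull ℝ (Set.range (vertex t d))) ∧
      (∀ μ₁ μ₂, IsInvariantMeasure φ μ₁ → IsInvariantMeasure φ μ₂ →
        ∀ a b : NNReal, a + b = 1 →
          IsInvariantMeasure φ (a • μ₁ + b • μ₂) ∧
          symbolVector Γ D R m (a • μ₁ + b • μ₂) =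
            a • symbolVector Γ D R m μ₁ + b • symbolVector Γ D R m μ₂) := by
  intro Γ D η φ
  have hpos : ∀ n, 1 ≤ n → n ≠ 0 := fun n hn => by omega
  let F : TiledGroup G (Fin r → ℤ) := tiledGroupOfComplement e hR1 hR
    (latticeTower hr p q₁ q₂ hp_dvd hp_large hindex hq₁ hq₂ hq htile)
  have hΓ : ∀ n, 1 ≤ n → ∀ g, g ∈ Γ n ↔ ∃ γ ∈ F.Λ n, F.emb γ = g := by
    intro n hn g
    have hΛ : F.Λ n = lattice (p n) := if_neg (hpos n hn)
    rw [hΛ]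
    rfl
  have hD : ∀ n, 1 ≤ n → ∀ g, g ∈ D n ↔ ∃ v ∈ F.B n, F.emb v = g := by
    intro n hn g
    have hB : F.B n = box (q₁ n) (q₂ n) := if_neg (hpos n hn)
    rw [hB]
    simp only [D, boxIn, Finset.mem_image]
    rfl
  have hB : F.B 0 = {0} :=
    if_pos (rfl : (0 : ℕ) = 0) (t := ({0} : Finset (Fin r → ℤ))) (e := box (q₁ 0) (q₂ 0))
  have heta : η = F.array m := F.eta_eq_array hΓ hD hB
  have hdens : ∀ n, 1 ≤ n → ∀ S : Set G, density D R n S =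
      (((F.U n : Set G) ∩ S).ncard : ℝ) / (F.U n).card := by
    intro n hn S
    have : DR D R n = F.U n := F.DR_eq_U hD hn
    rw [density, this]
  have hper : ∀ a, Tendsto (fun n => density D R n (Per η (Γ n) a)) atTop
      (𝓝 (F.perFreq m a)) := by
    intro a
    have hlim : Tendsto (fun n => F.symbolFreq m a n +
        if m = 1 ∧ a ≠ Fin.last m then F.gap n else 0) atTop (𝓝 (F.perFreq m a)) := by
      refine (F.tendsto_symbolFreq a).add ?_
      split_ifs
      exacts [F.tendsto_gap, tendsto_const_nhds]
    refine hlim.congr' ?_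
    filter_upwards [eventually_ge_atTop 1] with n hn
    rw [hdens n hn, heta, F.per_density hn (hΓ n hn)]
  obtain ⟨ν, hν1, hν2, hν3, hν4, hν5⟩ := F.exists_ergodic_measures heta
  have hvertex : vertex (F.perFreq m) (∑ a, F.perFreq m a) = F.extremeVec :=
    funext F.vertex_perFreq
  refine ⟨F.perFreq m, ∑ a, F.perFreq m a, ν, hper, ?_, hν1, hν2, fun i f => ?_, ?_, ?_, ?_, ?_⟩
  · refine (tendsto_finsetSum _ fun a _ => hper a).congr' ?_
    filter_upwards [eventually_ge_atTop 1] with n hn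
    rw [hdens n hn, F.perAll_density]
    exact Finset.sum_congr rfl fun a _ => hdens n hn _
  · have hn : Tendsto (fun s : ℕ => i.1 + s * m) atTop atTop :=
      tendsto_atTop_mono (fun s => (Nat.le_mul_of_pos_right s (NeZero.pos m)).trans
        (Nat.le_add_left _ _)) tendsto_id
    rw [Metric.tendsto_nhds]
    intro ε hε
    filter_upwards [hn.eventually (hν3 i f ε hε), hn.eventually (eventually_ge_atTop 1)] with s h hs
    rw [Real.dist_eq]
    -- The gap symbol of `η_n` is indexed by `n` modulo `m`, so all blocks along this progression
    -- have the same type `i`.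
    have hi : Fin.ofNat m (i.1 + s * m) = i := by
      ext
      simp [Nat.mod_eq_of_lt i.2]
    have ht := F.hasType_etaPeriodic (m := m) hΓ hD hB hs
    rw [hi] at ht
    have hint : ∫ x, f x ∂(periodicMeasure Γ D R m (i.1 + s * m)) = _ :=
      F.integral_periodicMeasure hD hs f
    rw [hint]
    exact h _ ht
  · rw [hvertex]
    exact F.linearIndependent_extremeVec
  · intro i
    rw [hvertex]
    exact hν4 i
  · rw [hvertex]
    exact hν5
  · intro μ₁ μ₂ h₁ h₂ a b hab
    refine ⟨isInvariantMeasure_smul_add_smul h₁ h₂ hab, ?_⟩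
    have := h₁.1
    have := h₂.1
    funext c
    simp only [symbolVector, Pi.add_apply, Pi.smul_apply]
    rw [measureReal_add_apply, measureReal_nnreal_smul_apply, measureReal_nnreal_smul_apply]
    rfl
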